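/- Let $C,\eta>0$ and $\varepsilon\in(0,1)$, and put $$C_{\mathrm{main}} = 512\,(48C)^{2+2/\eta}\,(6+6/\eta)^{1+4/\eta}.$$ For a square-integrable random vector $X$ in $\mathbb{R}^n$ (not necessarily centered) write $\Sigma=\mathbb{E}XX^T$ for its covariance matrix, let $\|\cdot\|_2$ be the Euclidean norm and $\|\cdot\|$ the spectral (operator) norm of matrices. Suppose that $\Sigma$ is invertible and that the isotropic random vector $Z=\Sigma^{-1/2}X$ satisfies the strong regularity assumption $$\mathbb{P}\{\|PZ\|_2^2>t\}\le C\,t^{-1-\eta}\quad\text{for } t>C\,\mathrm{rank}(P),\ \text{for every orthogonal projection } P \text{ in } \mathbb{R}^n. \tag{SR}$$ Let $\Sigma_N=\frac1N\sum_{i=1}^N X_iX_i^T$ be the sample covariance matrix of $N$ independent copies $X_1,\dots,X_N$ of $X$. If $$N\ge C_{\mathrm{main}}\,\varepsilon^{-2-2/\eta}\,n,$$ then $$\mathbb{E}\,\|\Sigma_N-\Sigma\|\le\varepsilon\,\|\Sigma\|.$$ Consequently the minimal sample size for covariance estimation is $O(n)$: for fixed $C,\eta,\varepsilon$ there is a constant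 $K=K(C,\eta,\varepsilon)$ such that for every $n$ the least integer $N_0$ with the property that $\mathbb{E}\|\Sigma_N-\Sigma\|\le\varepsilon\|\Sigma\|$ for all $N\ge N_0$ and all such random vectors $X$ in $\mathbb{R}^n$ satisfies $N_0\le Kn$. -/

import Mathlib

open MeasureTheory ProbabilityTheory

open scoped Matrix Matrix.Norms.L2Operator

/-- The matrix `E X Xᵀ` of a random vector `X` in `ℝⁿ`. As in the paper, this is what is called the
covariance matrix of `X`; `X` need not be centered. (Meaningful when `X` is square-integrable.) -/
noncomputable def covarianceMatrix {Ω : Type*} [MeasurableSpace Ω] {n : ℕ}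
    (X : Ω → EuclideanSpace ℝ (Fin n)) (P : Measure Ω) : Matrix (Fin n) (Fin n) ℝ :=
  Matrix.of fun i j => ∫ ω, X ω i * X ω j ∂P

/-- The sample covariance matrix `(1/N) ∑ᵢ xᵢ xᵢᵀ` of the vectors `x₁, …, x_N` in `ℝⁿ`. -/
noncomputable def sampleCovariance {n N : ℕ} (x : Fin N → EuclideanSpace ℝ (Fin n)) :
    Matrix (Fin n) (Fin n) ℝ :=
  (1 / (N : ℝ)) • ∑ i, Matrix.vecMulVec (x i).ofLp (x i).ofLp

/-- The power `S^{-1/2}` of a positive definite matrix `S`, by functional calculus. -/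
noncomputable def invSqrt {n : ℕ} (S : Matrix (Fin n) (Fin n) ℝ) : Matrix (Fin n) (Fin n) ℝ :=
  cfc (fun x : ℝ => x ^ (-(1 / 2) : ℝ)) S

/-- The normalized random vector `Z = Σ^{-1/2} X`, where `Σ = E X Xᵀ`. -/
noncomputable def whitened {Ω : Type*} [MeasurableSpace Ω] {n : ℕ}
    (X : Ω → EuclideanSpace ℝ (Fin n)) (P : Measure Ω) : Ω → EuclideanSpace ℝ (Fin n) :=
  fun ω => WithLp.toLp 2 (invSqrt (covarianceMatrix X P) *ᵥ (X ω).ofLp)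

/-- The strong regularity assumption (SR) with parameters `C`, `η` for a random vector `Z` in `ℝⁿ`:
`P {‖P_U Z‖² > t} ≤ C t^{-1-η}` for all `t > C · dim U`, for the orthogonal projection `P_U` onto
any linear subspace `U` (these are all the orthogonal projections, and `rank P_U = dim U`). -/
def StrongRegularity {Ω : Type*} [MeasurableSpace Ω] {n : ℕ} (C η : ℝ)
    (Z : Ω → EuclideanSpace ℝ (Fin n)) (P : Measure Ω) : Prop :=
  ∀ U : Submodule ℝ (EuclideanSpace ℝ (Fin n)), ∀ t : ℝ, C * (Module.finrank ℝ U : ℝ) < t →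
    P.real {ω | t < ‖U.starProjection (Z ω)‖ ^ 2} ≤ C * t ^ (-1 - η)

/-- The constant `C_main = 512 (48 C)^{2+2/η} (6+6/η)^{1+4/η}`. -/
noncomputable def mainConstant (C η : ℝ) : ℝ :=
  512 * (48 * C) ^ (2 + 2 / η) * (6 + 6 / η) ^ (1 + 4 / η)

/-- The sample sizes `N₀` that guarantee accuracy `ε` in dimension `n` for all distributions `μ`
on `ℝⁿ` with a finite second moment and an invertible covariance matrix `Σ` whose normalization
`Σ^{-1/2} X` satisfies (SR) with parameters `C`, `η`: for `N ≥ N₀` independent samples from `μ`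
(the coordinates under the `N`-fold product measure) one has `E ‖Σ_N - Σ‖ ≤ ε ‖Σ‖`. -/
def sufficientSampleSizes (C η ε : ℝ) (n : ℕ) : Set ℕ :=
  {N₀ | ∀ N : ℕ, N₀ ≤ N → ∀ μ : Measure (EuclideanSpace ℝ (Fin n)), IsProbabilityMeasure μ →
    MemLp id 2 μ → (covarianceMatrix id μ).PosDef → StrongRegularity C η (whitened id μ) μ →
    Integrable (fun x => ‖sampleCovariance x - covarianceMatrix id μ‖)
      (Measure.pi fun _ : Fin N => μ) ∧
    ∫ x, ‖sampleCovariance x - covarianceMatrix id μ‖ ∂(Measure.pi fun _ : Fin N => μ)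
      ≤ ε * ‖covarianceMatrix id μ‖}

/-! Whitening reduces everything to isotropic vectors: Σ_N - Σ = Q B Q with Q = Σ^{1/2} and B the
deviation of the whitened sample, and ‖Q‖² = ‖Σ‖.

The isotropic case is a randomized barrier argument in the style of Batson, Spielman and Srivastava.
A positive definite M measures the gap between a moving barrier and the current sum of the x xᵀ, and
the potential bound tr M⁻¹ ≤ φ keeps the barrier away from the spectrum. When a sample x arrives,
the barrier moves by δ(x), chosen so that the potential stays below φ. If every mean shift is at
most D, then N samples starting from M = cI with c = n/φ leave an extreme eigenvalue of mean at most
c + N D (`integral_topEig_le`). Here D is close to 1 for the upper barrier (`exists_upper_shift`)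
and close to -1 for the lower one (`exists_lower_shift`).

By the Sherman–Morrison formula the change of the potential depends only on the eigenvalues μ i of M
and on the squared coordinates ξ i of x in its eigenbasis (`barrier_up`, `barrier_low`). The upper
barrier needs ∑ ξ i / (μ i + δ) to be small. This is where (SR) is used in full: the eigenvalues are
grouped into scales, and the projection onto each group is controlled as a whole
(`exists_shift_resolvent_le`). The lower barrier needs only one-dimensional marginals.

Two one-sided bounds in mean do not bound the mean of the maximum. The gap is closed by the scalar
deviation in one fixed direction, controlled by truncation and variance
(`integral_abs_mean_sub_one_le`). -/

/-! ### Scalar inequalities for the barrier potentials. -/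

section Barrier

variable {ι : Type*} [Fintype ι]

theorem sum_inv_sub_sum_inv_add_ge {μ : ι → ℝ} {δ : ℝ} (hμ : ∀ i, 0 < μ i) (hδ : 0 ≤ δ) :
    δ * ∑ i, 1 / (μ i + δ) ^ 2 ≤ ∑ i, 1 / μ i - ∑ i, 1 / (μ i + δ) := by
  rw [Finset.mul_sum, ← Finset.sum_sub_distrib]
  refine Finset.sum_le_sum fun i _ => ?_
  have h := hμ i
  have h' : 0 < μ i + δ := by linarith
  rw [div_sub_div _ _ h.ne' h'.ne', mul_one_div, div_le_div_iff₀ (by positivity) (by positivity)]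
  have : 0 ≤ δ * (μ i + δ) * δ := by positivity
  nlinarith

/-- The shift alone lowers the potential by at least δ ∑ 1/(μ i + δ)², and the rank-one term must
cost no more. For δ at most κ times the least eigenvalue, `h2` suffices, since shifted and unshifted
sums agree up to (1 + κ)². For larger δ, `h1` suffices, since then m + δ is comparable to δ. -/
theorem barrier_up [Nonempty ι] {μ ξ : ι → ℝ} {δ κ : ℝ} (hμ : ∀ i, 0 < μ i) (hξ : ∀ i, 0 ≤ ξ i)
    (hδ : 0 ≤ δ) (hκ : 0 < κ)
    (h1 : ∑ i, ξ i / (μ i + δ) ≤ κ / (1 + 2 * κ))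
    (h2 : (1 + 2 * κ) * (1 + κ) * ((∑ i, ξ i / μ i ^ 2) / ∑ i, 1 / μ i ^ 2) ≤ δ) :
    ∑ i, 1 / (μ i + δ) + (∑ i, ξ i / (μ i + δ) ^ 2) / (1 - ∑ i, ξ i / (μ i + δ))
      ≤ ∑ i, 1 / μ i := by
  obtain ⟨i₀, hi₀⟩ := Finite.exists_min μ
  set m := μ i₀
  have hm : 0 < m := hμ i₀
  have hp : ∀ i, 0 < μ i + δ := fun i => by linarith [hμ i]
  have h3 := sum_inv_sub_sum_inv_add_ge hμ hδ
  set W := ∑ i, 1 / (μ i + δ) ^ 2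
  set q := ∑ i, ξ i / (μ i + δ) ^ 2 with hq
  have hW : 1 / (m + δ) ^ 2 ≤ W :=
    Finset.single_le_sum (f := fun i => 1 / (μ i + δ) ^ 2) (fun i _ => by positivity)
      (Finset.mem_univ i₀)
  have hq0 : 0 ≤ q := Finset.sum_nonneg fun i _ => div_nonneg (hξ i) (by positivity)
  have ht : 1 - κ / (1 + 2 * κ) = (1 + κ) / (1 + 2 * κ) := by field_simp; ring
  have hkey : q ≤ δ * W * ((1 + κ) / (1 + 2 * κ)) := by
    rcases le_or_gt δ (κ * m) with hc | hc
    · set V := ∑ i, 1 / μ i ^ 2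
      have hV : 0 < V := Finset.sum_pos (fun i _ => by have := hμ i; positivity) Finset.univ_nonempty
      have hVW : V ≤ (1 + κ) ^ 2 * W := by
        rw [Finset.mul_sum]
        refine Finset.sum_le_sum fun i _ => ?_
        have := hμ i
        have := hp i
        rw [mul_one_div, div_le_div_iff₀ (by positivity) (by positivity), one_mul, ← mul_pow]
        exact pow_le_pow_left₀ (by positivity) (by nlinarith [hi₀ i]) 2
      have hqg : q ≤ ∑ i, ξ i / μ i ^ 2 := by
        refine Finset.sum_le_sum fun i _ => ?_
        have := hμ i
        exact div_le_div_of_nonneg_left (hξ i) (by positivity)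
          (pow_le_pow_left₀ this.le (by linarith) 2)
      set G := ∑ i, ξ i / μ i ^ 2
      have hG : G = G / V * V := by field_simp
      have hG0 : 0 ≤ G / V := div_nonneg (hq0.trans hqg) hV.le
      calc q ≤ G / V * V := hG ▸ hqg
        _ ≤ G / V * ((1 + κ) ^ 2 * W) := by gcongr
        _ = ((1 + 2 * κ) * (1 + κ) * (G / V)) * W * ((1 + κ) / (1 + 2 * κ)) := by field_simp
        _ ≤ δ * W * ((1 + κ) / (1 + 2 * κ)) := by
            have : 0 ≤ W := le_trans (by positivity) hW
            gcongr
    · have hq1 : q ≤ (∑ i, ξ i / (μ i + δ)) / (m + δ) := by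
        rw [Finset.sum_div]
        refine Finset.sum_le_sum fun i _ => ?_
        rw [div_div, pow_two]
        have := hp i
        refine div_le_div_of_nonneg_left (hξ i) (by positivity) ?_
        have := hi₀ i
        gcongr
      have hW' : 1 / (m + δ) ≤ (m + δ) * W := by
        calc 1 / (m + δ) = (m + δ) * (1 / (m + δ) ^ 2) := by field_simp
          _ ≤ _ := by gcongr
      have hW0 : 0 ≤ W := le_trans (by positivity) hW
      calc q ≤ (κ / (1 + 2 * κ)) * (1 / (m + δ)) := by
            rw [mul_one_div]; exact hq1.trans (by gcongr)
        _ ≤ (κ / (1 + 2 * κ)) * ((m + δ) * W) := by gcongr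
        _ = (κ * m + κ * δ) * W / (1 + 2 * κ) := by ring
        _ ≤ (δ + κ * δ) * W / (1 + 2 * κ) := by gcongr
        _ = _ := by ring
  have hle : (1 + κ) / (1 + 2 * κ) ≤ 1 - ∑ i, ξ i / (μ i + δ) := by linarith
  have hpos : 0 < (1 + κ) / (1 + 2 * κ) := by positivity
  have : q / (1 - ∑ i, ξ i / (μ i + δ)) ≤ δ * W := by
    calc _ ≤ q / ((1 + κ) / (1 + 2 * κ)) := by gcongr
      _ ≤ δ * W := by rwa [div_le_iff₀ hpos]
  linarith

/-- Ensures that the lower barrier does not cross the spectrum: the shift shrinks each eigenvalue by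
a factor of at least 1 - τ. -/
theorem barrier_low_lt [Nonempty ι] {μ ξ : ι → ℝ} {τ : ℝ} (hμ : ∀ i, 0 < μ i) (hξ : ∀ i, 0 ≤ ξ i)
    (hτ : 0 ≤ τ) (h1 : ∑ i, ξ i / μ i ≤ τ) (i : ι) :
    (∑ i, ξ i / μ i ^ 2) / ∑ i, 1 / μ i ^ 2 ≤ τ * μ i := by
  obtain ⟨i₀, hi₀⟩ := Finite.exists_min μ
  refine le_trans ?_ (mul_le_mul_of_nonneg_left (hi₀ i) hτ)
  set m := μ i₀
  have hm : 0 < m := hμ i₀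
  have hV : 1 / m ^ 2 ≤ ∑ i, 1 / μ i ^ 2 :=
    Finset.single_le_sum (f := fun i => 1 / μ i ^ 2) (fun i _ => by have := hμ i; positivity)
      (Finset.mem_univ i₀)
  have hV0 : 0 < ∑ i, 1 / μ i ^ 2 := lt_of_lt_of_le (by positivity) hV
  rw [div_le_iff₀ hV0]
  calc ∑ i, ξ i / μ i ^ 2 ≤ ∑ i, ξ i / μ i / m := by
        refine Finset.sum_le_sum fun i _ => ?_
        have := hμ i
        rw [div_div, pow_two]
        exact div_le_div_of_nonneg_left (hξ i) (by positivity)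
          (mul_le_mul_of_nonneg_left (hi₀ i) this.le)
    _ ≤ τ / m := by rw [← Finset.sum_div]; gcongr
    _ = τ * m * (1 / m ^ 2) := by field_simp
    _ ≤ _ := by gcongr

/-- Two of the three factors 1 - τ pay for replacing μ i by μ i - δ in ∑ 1/μ i², the third for the
Sherman–Morrison denominator, which is at most 1/(1 - τ). -/
theorem barrier_low [Nonempty ι] {μ ξ : ι → ℝ} {δ τ : ℝ} (hμ : ∀ i, 0 < μ i) (hξ : ∀ i, 0 ≤ ξ i)
    (hτ : 0 < τ) (hτ1 : τ < 1) (h1 : ∑ i, ξ i / μ i ≤ τ)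
    (hδ : δ = (1 - τ) ^ 3 * ((∑ i, ξ i / μ i ^ 2) / ∑ i, 1 / μ i ^ 2)) :
    (∀ i, 0 < μ i - δ) ∧
    ∑ i, 1 / (μ i - δ) - (∑ i, ξ i / (μ i - δ) ^ 2) / (1 + ∑ i, ξ i / (μ i - δ))
      ≤ ∑ i, 1 / μ i := by
  set V := ∑ i, 1 / μ i ^ 2
  set G := ∑ i, ξ i / μ i ^ 2
  have h1τ : 0 < 1 - τ := by linarith
  have hV : 0 < V := Finset.sum_pos (fun i _ => by have := hμ i; positivity) Finset.univ_nonempty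
  have hG : 0 ≤ G := Finset.sum_nonneg fun i _ => div_nonneg (hξ i) (by positivity)
  have hδ0 : 0 ≤ δ := by rw [hδ]; positivity
  have hlow : ∀ i, (1 - τ) * μ i ≤ μ i - δ := fun i => by
    have h := barrier_low_lt hμ hξ hτ.le h1 i
    have hg : 0 ≤ G / V := by positivity
    have : (1 - τ) ^ 3 ≤ 1 := pow_le_one₀ h1τ.le (by linarith)
    nlinarith
  have hp : ∀ i, 0 < μ i - δ := fun i => lt_of_lt_of_le (mul_pos h1τ (hμ i)) (hlow i)
  refine ⟨hp, ?_⟩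
  set W := ∑ i, 1 / (μ i - δ) ^ 2
  have hW0 : 0 ≤ W := Finset.sum_nonneg fun i _ => by positivity
  have hVW : (1 - τ) ^ 2 * W ≤ V := by
    rw [Finset.mul_sum]
    refine Finset.sum_le_sum fun i _ => ?_
    have := hμ i
    have := hp i
    rw [mul_one_div, div_le_div_iff₀ (by positivity) (by positivity), one_mul, ← mul_pow]
    exact pow_le_pow_left₀ (by positivity) (hlow i) 2
  have hdiff : ∑ i, 1 / (μ i - δ) - ∑ i, 1 / μ i ≤ δ * W := by
    rw [Finset.mul_sum, ← Finset.sum_sub_distrib]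
    refine Finset.sum_le_sum fun i _ => ?_
    have h := hμ i
    have h' := hp i
    rw [div_sub_div _ _ h'.ne' h.ne', mul_one_div, div_le_div_iff₀ (by positivity) (by positivity)]
    have : 0 ≤ δ * (μ i - δ) * δ := by positivity
    nlinarith
  have hq1 : 1 + ∑ i, ξ i / (μ i - δ) ≤ 1 / (1 - τ) := by
    have : ∑ i, ξ i / (μ i - δ) ≤ τ / (1 - τ) := by
      calc ∑ i, ξ i / (μ i - δ) ≤ ∑ i, ξ i / μ i / (1 - τ) := by
            refine Finset.sum_le_sum fun i _ => ?_
            have := hμ i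
            rw [div_div]
            exact div_le_div_of_nonneg_left (hξ i) (by positivity) (by linarith [hlow i])
        _ ≤ _ := by rw [← Finset.sum_div]; gcongr
    have h' : 1 / (1 - τ) = 1 + τ / (1 - τ) := by field_simp; ring
    linarith
  have hq1' : 0 < 1 + ∑ i, ξ i / (μ i - δ) := by
    have : 0 ≤ ∑ i, ξ i / (μ i - δ) := Finset.sum_nonneg fun i _ => div_nonneg (hξ i) (hp i).le
    linarith
  have hGq : G ≤ ∑ i, ξ i / (μ i - δ) ^ 2 := by
    refine Finset.sum_le_sum fun i _ => ?_
    have := hp i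
    exact div_le_div_of_nonneg_left (hξ i) (by positivity)
      (pow_le_pow_left₀ this.le (by linarith) 2)
  have : δ * W ≤ (∑ i, ξ i / (μ i - δ) ^ 2) / (1 + ∑ i, ξ i / (μ i - δ)) := by
    calc δ * W = (1 - τ) * (G / V * ((1 - τ) ^ 2 * W)) := by rw [hδ]; ring
      _ ≤ (1 - τ) * (G / V * V) := by gcongr
      _ = G / (1 / (1 - τ)) := by field_simp
      _ ≤ (∑ i, ξ i / (μ i - δ) ^ 2) / (1 / (1 - τ)) := by gcongr
      _ ≤ _ := by
        gcongr
        exact hG.trans hGq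
  linarith

end Barrier

/-! ### Shifts and rank-one updates in the eigenbasis. -/

section RankOne

variable {n : ℕ}

/-- Cauchy–Schwarz with weights d i: (∑ y i v i)² ≤ (∑ y i²/d i)(∑ d i v i²). -/
theorem posDef_diagonal_sub_vecMulVec {d y : Fin n → ℝ} {σ : ℝ} (hd : ∀ i, 0 < d i)
    (hK : 0 < 1 - σ * ∑ i, y i ^ 2 / d i) :
    (Matrix.diagonal d - σ • Matrix.vecMulVec y y).PosDef := by
  refine Matrix.PosDef.of_dotProduct_mulVec_pos ?_ ?_
  · ext i j
    by_cases h : i = j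
    · subst h; simp
    · simp [Matrix.vecMulVec_apply, h, Ne.symm h, mul_comm]
  · intro v hv
    have hv' : star v ⬝ᵥ (Matrix.diagonal d - σ • Matrix.vecMulVec y y) *ᵥ v
        = ∑ i, d i * v i ^ 2 - σ * (∑ i, y i * v i) ^ 2 := by
      rw [Matrix.sub_mulVec, dotProduct_sub, Matrix.smul_mulVec, Matrix.vecMulVec_mulVec]
      simp only [dotProduct, Matrix.mulVec_diagonal, Pi.star_apply, star_trivial, Pi.smul_apply,
        smul_eq_mul, MulOpposite.smul_eq_mul_unop, MulOpposite.unop_op]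
      congr 1
      · exact Finset.sum_congr rfl fun i _ => by ring
      · rw [pow_two, Finset.sum_mul, Finset.mul_sum]
        exact Finset.sum_congr rfl fun i _ => by ring
    rw [hv']
    obtain ⟨j, hj⟩ := Function.ne_iff.mp hv
    have hD : 0 < ∑ i, d i * v i ^ 2 := by
      refine Finset.sum_pos' (fun i _ => mul_nonneg (hd i).le (sq_nonneg _)) ⟨j, Finset.mem_univ _, ?_⟩
      have : v j ≠ 0 := hj
      exact mul_pos (hd j) (by positivity)
    have hCS : (∑ i, y i * v i) ^ 2 ≤ (∑ i, y i ^ 2 / d i) * ∑ i, d i * v i ^ 2 := by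
      refine Finset.sum_sq_le_sum_mul_sum_of_sq_le_mul _ (fun i _ => ?_) (fun i _ => ?_)
        fun i _ => ?_
      · have := hd i; positivity
      · have := hd i; positivity
      · have := (hd i).ne'
        refine le_of_eq ?_
        field_simp
    have h0 := sq_nonneg (∑ i, y i * v i)
    rcases le_or_gt σ 0 with hσ | hσ
    · nlinarith
    · nlinarith [mul_le_mul_of_nonneg_left hCS hσ.le, mul_pos hK hD]

/-- The Sherman–Morrison formula, checked by multiplying out. -/
theorem inv_diagonal_sub_vecMulVec {d y : Fin n → ℝ} {σ : ℝ} (hd : ∀ i, 0 < d i)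
    (hK : 0 < 1 - σ * ∑ i, y i ^ 2 / d i) :
    (Matrix.diagonal d - σ • Matrix.vecMulVec y y)⁻¹ =
      Matrix.diagonal (fun i => 1 / d i) + (σ / (1 - σ * ∑ i, y i ^ 2 / d i)) •
        Matrix.vecMulVec (fun i => y i / d i) (fun i => y i / d i) := by
  apply Matrix.inv_eq_right_inv
  set K := 1 - σ * ∑ i, y i ^ 2 / d i with hKdef
  have h1 : Matrix.diagonal d * Matrix.diagonal (fun i => 1 / d i) = 1 := by
    rw [Matrix.diagonal_mul_diagonal, ← Matrix.diagonal_one]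
    congr 1; ext i; have := (hd i).ne'; field_simp
  have h2 : Matrix.diagonal d * Matrix.vecMulVec (fun i => y i / d i) (fun i => y i / d i)
      = Matrix.vecMulVec y (fun i => y i / d i) := by
    ext i j
    rw [Matrix.diagonal_mul, Matrix.vecMulVec_apply, Matrix.vecMulVec_apply]
    have := (hd i).ne'; field_simp
  have h3 : Matrix.vecMulVec y y * Matrix.diagonal (fun i => 1 / d i)
      = Matrix.vecMulVec y (fun i => y i / d i) := by
    ext i j
    rw [Matrix.mul_diagonal, Matrix.vecMulVec_apply, Matrix.vecMulVec_apply]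
    ring
  have h4 : Matrix.vecMulVec y y * Matrix.vecMulVec (fun i => y i / d i) (fun i => y i / d i)
      = (∑ i, y i ^ 2 / d i) • Matrix.vecMulVec y (fun i => y i / d i) := by
    ext i j
    rw [Matrix.mul_apply, Matrix.smul_apply, Matrix.vecMulVec_apply, smul_eq_mul, Finset.sum_mul]
    refine Finset.sum_congr rfl fun k _ => ?_
    rw [Matrix.vecMulVec_apply, Matrix.vecMulVec_apply]
    ring
  rw [sub_mul, mul_add, mul_add, h1, Matrix.mul_smul, h2, Matrix.smul_mul, h3, Matrix.smul_mul,
    Matrix.mul_smul, h4, smul_smul, smul_smul, add_sub_assoc, ← add_smul, ← sub_smul]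
  have : σ / K - (σ + σ * (σ / K) * ∑ i, y i ^ 2 / d i) = 0 := by
    have hs : σ * ∑ i, y i ^ 2 / d i = 1 - K := by rw [hKdef]; ring
    have : σ * (σ / K) * ∑ i, y i ^ 2 / d i = σ / K * (1 - K) := by rw [← hs]; ring
    rw [this]; field_simp; ring
  rw [this, zero_smul, add_zero]

theorem trace_inv_diagonal_sub_vecMulVec {d y : Fin n → ℝ} {σ : ℝ} (hd : ∀ i, 0 < d i)
    (hK : 0 < 1 - σ * ∑ i, y i ^ 2 / d i) :
    (Matrix.diagonal d - σ • Matrix.vecMulVec y y)⁻¹.trace =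
      ∑ i, 1 / d i + σ * (∑ i, y i ^ 2 / d i ^ 2) / (1 - σ * ∑ i, y i ^ 2 / d i) := by
  rw [inv_diagonal_sub_vecMulVec hd hK, Matrix.trace_add, Matrix.trace_smul,
    Matrix.trace_diagonal, Matrix.trace_vecMulVec, smul_eq_mul, div_mul_eq_mul_div]
  congr 3
  exact Finset.sum_congr rfl fun i _ => by ring

variable {M : Matrix (Fin n) (Fin n) ℝ}

theorem shift_sub_vecMulVec_eq_conj (hM : M.IsHermitian) (δ σ : ℝ)
    (x : EuclideanSpace ℝ (Fin n)) :
    M + δ • (1 : Matrix (Fin n) (Fin n) ℝ) - σ • Matrix.vecMulVec x.ofLp x.ofLp =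
      (hM.eigenvectorUnitary : Matrix (Fin n) (Fin n) ℝ) *
        (Matrix.diagonal (fun i => hM.eigenvalues i + δ) - σ • Matrix.vecMulVec
          (fun i => inner ℝ (hM.eigenvectorBasis i) x) fun i => inner ℝ (hM.eigenvectorBasis i) x) *
        star (hM.eigenvectorUnitary : Matrix (Fin n) (Fin n) ℝ) := by
  set U := (hM.eigenvectorUnitary : Matrix (Fin n) (Fin n) ℝ) with hU
  have hUU : U * star U = 1 := Unitary.coe_mul_star_self _
  have hy : (fun i => inner ℝ (hM.eigenvectorBasis i) x) = star U *ᵥ x.ofLp := by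
    ext i
    rw [EuclideanSpace.inner_eq_star_dotProduct]
    simp [Matrix.mulVec, dotProduct, hU, Matrix.star_apply, Matrix.IsHermitian.eigenvectorUnitary_apply,
      mul_comm]
  have hx : U *ᵥ (star U *ᵥ x.ofLp) = x.ofLp := by
    rw [Matrix.mulVec_mulVec, hUU, Matrix.one_mulVec]
  have hd : Matrix.diagonal (fun i => hM.eigenvalues i + δ)
      = Matrix.diagonal hM.eigenvalues + δ • (1 : Matrix (Fin n) (Fin n) ℝ) := by
    rw [← Matrix.diagonal_one, ← Matrix.diagonal_smul, Matrix.diagonal_add]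
    congr 1; ext i; simp
  have hspec : M = U * Matrix.diagonal hM.eigenvalues * star U := by
    conv_lhs => rw [hM.spectral_theorem, Unitary.conjStarAlgAut_apply]
    rfl
  have hvec : U * Matrix.vecMulVec (star U *ᵥ x.ofLp) (star U *ᵥ x.ofLp) * star U
      = Matrix.vecMulVec x.ofLp x.ofLp := by
    rw [Matrix.mul_vecMulVec, hx, Matrix.vecMulVec_mul]
    congr 1
    rw [← Matrix.mulVec_transpose]
    have : (star U)ᵀ = U := by
      rw [Matrix.star_eq_conjTranspose, Matrix.conjTranspose_eq_transpose_of_trivial,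
        Matrix.transpose_transpose]
    rw [this, hx]
  rw [hy, hd, mul_sub, sub_mul, mul_add, add_mul, ← hspec, Matrix.mul_smul, Matrix.smul_mul,
    mul_one, hUU, Matrix.mul_smul, Matrix.smul_mul, hvec]

theorem posDef_shift_sub_vecMulVec (hM : M.IsHermitian) {δ σ : ℝ} (x : EuclideanSpace ℝ (Fin n))
    (hd : ∀ i, 0 < hM.eigenvalues i + δ)
    (hK : 0 < 1 - σ * ∑ i, inner ℝ (hM.eigenvectorBasis i) x ^ 2 / (hM.eigenvalues i + δ)) :
    (M + δ • (1 : Matrix (Fin n) (Fin n) ℝ) - σ • Matrix.vecMulVec x.ofLp x.ofLp).PosDef ∧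
    (M + δ • (1 : Matrix (Fin n) (Fin n) ℝ) - σ • Matrix.vecMulVec x.ofLp x.ofLp)⁻¹.trace =
      ∑ i, 1 / (hM.eigenvalues i + δ) +
        σ * (∑ i, inner ℝ (hM.eigenvectorBasis i) x ^ 2 / (hM.eigenvalues i + δ) ^ 2) /
        (1 - σ * ∑ i, inner ℝ (hM.eigenvectorBasis i) x ^ 2 / (hM.eigenvalues i + δ)) := by
  rw [shift_sub_vecMulVec_eq_conj hM]
  have hunit : IsUnit (hM.eigenvectorUnitary : Matrix (Fin n) (Fin n) ℝ) :=
    ⟨Unitary.toUnits hM.eigenvectorUnitary, rfl⟩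
  refine ⟨(Matrix.IsUnit.posDef_star_right_conjugate_iff hunit).2
    (posDef_diagonal_sub_vecMulVec hd hK), ?_⟩
  rw [← trace_inv_diagonal_sub_vecMulVec hd hK]
  have hUU : star (hM.eigenvectorUnitary : Matrix (Fin n) (Fin n) ℝ) *
    (hM.eigenvectorUnitary : Matrix (Fin n) (Fin n) ℝ) = 1 := Unitary.coe_star_mul_self _
  have hinv : (star (hM.eigenvectorUnitary : Matrix (Fin n) (Fin n) ℝ))⁻¹ =
    (hM.eigenvectorUnitary : Matrix (Fin n) (Fin n) ℝ) := Matrix.inv_eq_right_inv hUU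
  rw [Matrix.mul_inv_rev, Matrix.mul_inv_rev, hinv, ← mul_assoc,
    Matrix.trace_mul_comm, ← mul_assoc, Matrix.inv_eq_left_inv hUU, hUU, one_mul]

theorem trace_inv_eq_sum (hM : M.PosDef) :
    M⁻¹.trace = ∑ i, 1 / hM.isHermitian.eigenvalues i := by
  have := (posDef_shift_sub_vecMulVec hM.isHermitian (δ := 0) (σ := 0) 0
    (fun i => by simpa using hM.eigenvalues_pos i) (by simp)).2
  simpa using this

end RankOne

/-! ### Quadratic forms and the top eigenvalue. -/

section TopEig

variable {n : ℕ}

/-- The quadratic form `vᵀ B v` of a matrix. -/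
def quadForm (B : Matrix (Fin n) (Fin n) ℝ) (v : EuclideanSpace ℝ (Fin n)) : ℝ :=
  v.ofLp ⬝ᵥ (B *ᵥ v.ofLp)

theorem quadForm_add (A B : Matrix (Fin n) (Fin n) ℝ) (v : EuclideanSpace ℝ (Fin n)) :
    quadForm (A + B) v = quadForm A v + quadForm B v := by
  simp [quadForm, Matrix.add_mulVec, dotProduct_add]

theorem quadForm_sub (A B : Matrix (Fin n) (Fin n) ℝ) (v : EuclideanSpace ℝ (Fin n)) :
    quadForm (A - B) v = quadForm A v - quadForm B v := by
  simp [quadForm, Matrix.sub_mulVec, dotProduct_sub]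

theorem quadForm_neg (A : Matrix (Fin n) (Fin n) ℝ) (v : EuclideanSpace ℝ (Fin n)) :
    quadForm (-A) v = -quadForm A v := by
  simp [quadForm, Matrix.neg_mulVec, dotProduct_neg]

theorem quadForm_smul (c : ℝ) (A : Matrix (Fin n) (Fin n) ℝ) (v : EuclideanSpace ℝ (Fin n)) :
    quadForm (c • A) v = c * quadForm A v := by
  simp [quadForm, Matrix.smul_mulVec, dotProduct_smul]

theorem quadForm_one (v : EuclideanSpace ℝ (Fin n)) :
    quadForm (1 : Matrix (Fin n) (Fin n) ℝ) v = ‖v‖ ^ 2 := by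
  rw [quadForm, Matrix.one_mulVec, EuclideanSpace.real_norm_sq_eq, dotProduct]
  exact Finset.sum_congr rfl fun i _ => by ring

theorem quadForm_vecMulVec (x v : EuclideanSpace ℝ (Fin n)) :
    quadForm (Matrix.vecMulVec x.ofLp x.ofLp) v = inner ℝ v x ^ 2 := by
  rw [quadForm, Matrix.vecMulVec_mulVec, EuclideanSpace.inner_eq_star_dotProduct]
  simp [dotProduct_smul, dotProduct_comm, pow_two]

theorem quadForm_sum {ι : Type*} (s : Finset ι) (A : ι → Matrix (Fin n) (Fin n) ℝ)
    (v : EuclideanSpace ℝ (Fin n)) :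
    quadForm (∑ i ∈ s, A i) v = ∑ i ∈ s, quadForm (A i) v := by
  classical
  induction s using Finset.induction_on with
  | empty => simp [quadForm]
  | insert i s hi ih => rw [Finset.sum_insert hi, quadForm_add, ih, Finset.sum_insert hi]

theorem quadForm_eq_inner (B : Matrix (Fin n) (Fin n) ℝ) (v : EuclideanSpace ℝ (Fin n)) :
    quadForm B v = inner ℝ (Matrix.toEuclideanCLM (n := Fin n) (𝕜 := ℝ) B v) v := by
  rw [quadForm, EuclideanSpace.inner_eq_star_dotProduct, Matrix.ofLp_toEuclideanCLM]
  simp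

theorem quadForm_vec_smul (B : Matrix (Fin n) (Fin n) ℝ) (c : ℝ) (v : EuclideanSpace ℝ (Fin n)) :
    quadForm B (c • v) = c ^ 2 * quadForm B v := by
  simp [quadForm, Matrix.mulVec_smul, dotProduct_smul, smul_dotProduct]
  ring

theorem abs_quadForm_le (B : Matrix (Fin n) (Fin n) ℝ) (v : EuclideanSpace ℝ (Fin n)) :
    |quadForm B v| ≤ ‖B‖ * ‖v‖ ^ 2 := by
  rw [quadForm_eq_inner, ← Matrix.l2_opNorm_toEuclideanCLM]
  refine (abs_real_inner_le_norm _ _).trans ?_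
  rw [pow_two, ← mul_assoc]
  gcongr
  exact ContinuousLinearMap.le_opNorm _ _

/-- The largest eigenvalue of a symmetric matrix, as the supremum of the quadratic form over the
unit sphere. -/
noncomputable def topEig (B : Matrix (Fin n) (Fin n) ℝ) : ℝ :=
  ⨆ v : Metric.sphere (0 : EuclideanSpace ℝ (Fin n)) 1, quadForm B v

theorem quadForm_le_topEig (B : Matrix (Fin n) (Fin n) ℝ) {v : EuclideanSpace ℝ (Fin n)}
    (hv : ‖v‖ = 1) : quadForm B v ≤ topEig B := by
  refine le_ciSup (f := fun v : Metric.sphere (0 : EuclideanSpace ℝ (Fin n)) 1 => quadForm B v)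
    ⟨‖B‖, ?_⟩ ⟨v, by simpa using hv⟩
  rintro _ ⟨w, rfl⟩
  have hw : ‖(w : EuclideanSpace ℝ (Fin n))‖ = 1 := by simp
  simpa [hw] using (le_abs_self _).trans (abs_quadForm_le B w)

theorem quadForm_le_topEig_mul (B : Matrix (Fin n) (Fin n) ℝ) (v : EuclideanSpace ℝ (Fin n)) :
    quadForm B v ≤ topEig B * ‖v‖ ^ 2 := by
  rcases eq_or_ne v 0 with rfl | hv
  · simp [quadForm]
  · have hv' : ‖v‖ ≠ 0 := norm_ne_zero_iff.2 hv
    have h : v = ‖v‖ • ((‖v‖)⁻¹ • v) := by rw [smul_smul, mul_inv_cancel₀ hv', one_smul]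
    conv_lhs => rw [h, quadForm_vec_smul, mul_comm]
    gcongr
    apply quadForm_le_topEig
    rw [norm_smul, norm_inv, norm_norm, inv_mul_cancel₀ hv']

variable [NeZero n]

theorem topEig_le {B : Matrix (Fin n) (Fin n) ℝ} {c : ℝ}
    (h : ∀ v : EuclideanSpace ℝ (Fin n), ‖v‖ = 1 → quadForm B v ≤ c) : topEig B ≤ c := by
  have : Nonempty (Metric.sphere (0 : EuclideanSpace ℝ (Fin n)) 1) :=
    (NormedSpace.sphere_nonempty.2 zero_le_one).to_subtype
  exact ciSup_le fun v => h v (by simp)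

theorem exists_unit_vector (n : ℕ) [NeZero n] : ∃ v : EuclideanSpace ℝ (Fin n), ‖v‖ = 1 :=
  ⟨EuclideanSpace.single 0 1, by simp⟩

theorem topEig_add_smul_one (B : Matrix (Fin n) (Fin n) ℝ) (c : ℝ) :
    topEig (B + c • (1 : Matrix (Fin n) (Fin n) ℝ)) = topEig B + c := by
  have key : ∀ (B : Matrix (Fin n) (Fin n) ℝ) (c : ℝ),
      topEig (B + c • (1 : Matrix (Fin n) (Fin n) ℝ)) ≤ topEig B + c := fun B c =>
    topEig_le fun v hv => by
      rw [quadForm_add, quadForm_smul, quadForm_one, hv]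
      linarith [quadForm_le_topEig B hv]
  refine le_antisymm (key B c) ?_
  have := key (B + c • (1 : Matrix (Fin n) (Fin n) ℝ)) (-c)
  rw [neg_smul, add_neg_cancel_right] at this
  linarith

theorem topEig_sub_le (A B : Matrix (Fin n) (Fin n) ℝ) : topEig A - topEig B ≤ ‖A - B‖ := by
  rw [sub_le_iff_le_add]
  refine topEig_le fun v hv => ?_
  have h := (le_abs_self _).trans (abs_quadForm_le (A - B) v)
  rw [quadForm_sub, hv] at h
  linarith [quadForm_le_topEig B hv]

/-- Needed for measurability of the random top eigenvalue. -/
theorem continuous_topEig : Continuous (topEig : Matrix (Fin n) (Fin n) ℝ → ℝ) := by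
  refine LipschitzWith.continuous (K := 1) (LipschitzWith.of_dist_le_mul fun A B => ?_)
  rw [NNReal.coe_one, one_mul, Real.dist_eq, dist_eq_norm, abs_le]
  have h1 := topEig_sub_le A B
  have h2 := topEig_sub_le B A
  rw [norm_sub_rev] at h2
  constructor <;> linarith

theorem abs_topEig_le (B : Matrix (Fin n) (Fin n) ℝ) : |topEig B| ≤ ‖B‖ := by
  rw [abs_le]
  obtain ⟨v, hv⟩ := exists_unit_vector n
  have h := abs_le.1 (abs_quadForm_le B v)
  rw [hv] at h
  refine ⟨by linarith [h.1, quadForm_le_topEig B hv], topEig_le fun w hw => ?_⟩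
  simpa [hw] using (le_abs_self _).trans (abs_quadForm_le B w)

theorem norm_le_max_topEig {B : Matrix (Fin n) (Fin n) ℝ} (hB : B.IsHermitian) :
    ‖B‖ ≤ max (topEig B) (topEig (-B)) := by
  have hsymm : (Matrix.toEuclideanCLM (n := Fin n) (𝕜 := ℝ) B).IsSymmetric :=
    Matrix.isSymmetric_toEuclideanLin_iff.2 hB
  rw [← Matrix.l2_opNorm_toEuclideanCLM,
    ContinuousLinearMap.norm_eq_iSup_rayleighQuotient _ hsymm]
  refine ciSup_le fun v => ?_
  have hq : (Matrix.toEuclideanCLM (n := Fin n) (𝕜 := ℝ) B).reApplyInnerSelf v = quadForm B v := by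
    rw [quadForm_eq_inner]; rfl
  rw [ContinuousLinearMap.rayleighQuotient, hq]
  rcases eq_or_ne v 0 with rfl | hv
  -- At v = 0 the Rayleigh quotient is 0 / 0 = 0. The maximum is nonnegative because the two suprema
  -- bound some number and its negative.
  · obtain ⟨w, hw⟩ := exists_unit_vector n
    have h1 := quadForm_le_topEig B hw
    have h2 := quadForm_le_topEig (-B) hw
    rw [quadForm_neg] at h2
    simp only [quadForm, norm_zero, ne_eq, OfNat.ofNat_ne_zero, not_false_eq_true, zero_pow,
      div_zero, abs_zero, le_sup_iff]
    by_contra! hcon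
    linarith [hcon.1, hcon.2]
  · have hv' : 0 < ‖v‖ ^ 2 := by have := norm_pos_iff.2 hv; positivity
    have h1 := quadForm_le_topEig_mul B v
    have h2 := quadForm_le_topEig_mul (-B) v
    rw [quadForm_neg] at h2
    rw [abs_div, abs_of_pos hv', div_le_iff₀ hv', abs_le']
    constructor
    · exact h1.trans (by gcongr; exact le_max_left _ _)
    · exact h2.trans (by gcongr; exact le_max_right _ _)

theorem topEig_neg_le_zero_of_posDef {M : Matrix (Fin n) (Fin n) ℝ} (hM : M.PosDef) :
    topEig (-M) ≤ 0 := by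
  refine topEig_le fun v _ => ?_
  rw [quadForm_neg, neg_nonpos]
  simpa [quadForm] using hM.posSemidef.dotProduct_mulVec_nonneg v.ofLp

end TopEig

/-! ### Adding the samples one at a time. -/

section Induction

variable {n : ℕ}

theorem norm_vecMulVec_le (x : EuclideanSpace ℝ (Fin n)) :
    ‖Matrix.vecMulVec x.ofLp x.ofLp‖ ≤ ‖x‖ ^ 2 := by
  rw [← Matrix.l2_opNorm_toEuclideanCLM]
  refine ContinuousLinearMap.opNorm_le_bound _ (by positivity) fun v => ?_
  have h : Matrix.toEuclideanCLM (n := Fin n) (𝕜 := ℝ) (Matrix.vecMulVec x.ofLp x.ofLp) v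
      = inner ℝ x v • x := by
    ext i
    rw [Matrix.ofLp_toEuclideanCLM, Matrix.vecMulVec_mulVec,
      EuclideanSpace.inner_eq_star_dotProduct]
    simp [mul_comm, dotProduct_comm]
  rw [h, norm_smul, pow_two, mul_right_comm]
  gcongr
  exact norm_inner_le_norm x v

theorem continuous_sum_vecMulVec (N : ℕ) :
    Continuous fun x : Fin N → EuclideanSpace ℝ (Fin n) =>
      ∑ i, Matrix.vecMulVec (x i).ofLp (x i).ofLp := by
  refine continuous_finsetSum _ fun i _ => ?_
  have h : Continuous fun x : Fin N → EuclideanSpace ℝ (Fin n) => (x i).ofLp := by fun_prop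
  exact h.matrix_vecMulVec h

theorem integrable_norm_sq_eval {ν : Measure (EuclideanSpace ℝ (Fin n))} [IsProbabilityMeasure ν]
    (hν : MemLp id 2 ν) (N : ℕ) :
    Integrable (fun x : Fin N → EuclideanSpace ℝ (Fin n) => ∑ i, ‖x i‖ ^ 2)
      (Measure.pi fun _ => ν) := by
  refine integrable_finsetSum _ fun i _ => ?_
  exact integrable_comp_eval (μ := fun _ : Fin N => ν) (f := fun y => ‖y‖ ^ 2) hν.integrable_norm_pow'

theorem norm_smul_sum_vecMulVec_sub_le (N : ℕ) (σ : ℝ) (M : Matrix (Fin n) (Fin n) ℝ)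
    (x : Fin N → EuclideanSpace ℝ (Fin n)) :
    ‖σ • ∑ i, Matrix.vecMulVec (x i).ofLp (x i).ofLp - M‖ ≤ |σ| * ∑ i, ‖x i‖ ^ 2 + ‖M‖ := by
  refine (norm_sub_le _ _).trans ?_
  rw [norm_smul, Real.norm_eq_abs]
  gcongr
  exact (norm_sum_le _ _).trans (Finset.sum_le_sum fun i _ => norm_vecMulVec_le _)

theorem integrable_norm_smul_sum_vecMulVec_sub {ν : Measure (EuclideanSpace ℝ (Fin n))}
    [IsProbabilityMeasure ν] (hν : MemLp id 2 ν) (N : ℕ) (σ : ℝ) (M : Matrix (Fin n) (Fin n) ℝ) :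
    Integrable (fun x : Fin N → EuclideanSpace ℝ (Fin n) =>
      ‖σ • ∑ i, Matrix.vecMulVec (x i).ofLp (x i).ofLp - M‖) (Measure.pi fun _ => ν) := by
  refine (((integrable_norm_sq_eval hν N).const_mul |σ|).add (integrable_const ‖M‖)).mono'
    ?_ (Filter.Eventually.of_forall fun x => ?_)
  · exact (((continuous_sum_vecMulVec N).const_smul σ).sub
      continuous_const).norm.measurable.aestronglyMeasurable
  · rw [norm_norm]
    exact norm_smul_sum_vecMulVec_sub_le N σ M x

variable [NeZero n]

theorem integrable_topEig {ν : Measure (EuclideanSpace ℝ (Fin n))}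
    [IsProbabilityMeasure ν] (hν : MemLp id 2 ν) (N : ℕ) (σ : ℝ) (M : Matrix (Fin n) (Fin n) ℝ) :
    Integrable (fun x : Fin N → EuclideanSpace ℝ (Fin n) =>
      topEig (σ • ∑ i, Matrix.vecMulVec (x i).ofLp (x i).ofLp - M)) (Measure.pi fun _ => ν) := by
  refine (integrable_norm_smul_sum_vecMulVec_sub hν N σ M).mono'
    ?_ (Filter.Eventually.of_forall fun x => abs_topEig_le _)
  exact (continuous_topEig.comp (((continuous_sum_vecMulVec N).const_smul σ).sub
      continuous_const)).measurable.aestronglyMeasurable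

/-- Conditioning on the first sample y turns M into the updated matrix M' and splits off the shift δ
y, so Fubini reduces N + 1 samples to N. The statement covers every admissible M because M' depends
on y. -/
theorem integral_topEig_le {ν : Measure (EuclideanSpace ℝ (Fin n))} [IsProbabilityMeasure ν]
    (hν : MemLp id 2 ν) {φ D σ : ℝ}
    (step : ∀ M : Matrix (Fin n) (Fin n) ℝ, M.PosDef → M⁻¹.trace ≤ φ →
      ∃ δ : EuclideanSpace ℝ (Fin n) → ℝ, Integrable δ ν ∧ ∫ x, δ x ∂ν ≤ D ∧
        ∀ x, (M + δ x • (1 : Matrix (Fin n) (Fin n) ℝ)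
            - σ • Matrix.vecMulVec x.ofLp x.ofLp).PosDef ∧
          (M + δ x • (1 : Matrix (Fin n) (Fin n) ℝ)
            - σ • Matrix.vecMulVec x.ofLp x.ofLp)⁻¹.trace ≤ φ) (N : ℕ) :
    ∀ M : Matrix (Fin n) (Fin n) ℝ, M.PosDef → M⁻¹.trace ≤ φ →
      ∫ x : Fin N → EuclideanSpace ℝ (Fin n),
        topEig (σ • ∑ i, Matrix.vecMulVec (x i).ofLp (x i).ofLp - M) ∂(Measure.pi fun _ => ν)
        ≤ N * D := by
  induction N with
  | zero =>
    intro M hM _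
    simpa using topEig_neg_le_zero_of_posDef hM
  | succ N ih =>
    intro M hM htr
    obtain ⟨δ, hδ, hδD, hstep⟩ := step M hM htr
    set F : (Fin (N + 1) → EuclideanSpace ℝ (Fin n)) → ℝ := fun x =>
      topEig (σ • ∑ i, Matrix.vecMulVec (x i).ofLp (x i).ofLp - M) with hF
    set G : EuclideanSpace ℝ (Fin n) × (Fin N → EuclideanSpace ℝ (Fin n)) → ℝ := fun p =>
      topEig (σ • (Matrix.vecMulVec p.1.ofLp p.1.ofLp +
        ∑ i, Matrix.vecMulVec (p.2 i).ofLp (p.2 i).ofLp) - M) with hG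
    have hmp := measurePreserving_piFinSuccAbove (fun _ : Fin (N + 1) => ν) 0
    have hFG : F = fun x => G (MeasurableEquiv.piFinSuccAbove
        (fun _ : Fin (N + 1) => EuclideanSpace ℝ (Fin n)) 0 x) := by
      ext x
      simp only [hF, hG, Fin.sum_univ_succ]
      rfl
    have hGint : Integrable G (ν.prod (Measure.pi fun _ : Fin N => ν)) := by
      rw [← hmp.integrable_comp_emb (MeasurableEquiv.measurableEmbedding _)]
      have := integrable_topEig hν (N + 1) σ M
      rw [← hF, hFG] at this
      exact this
    rw [hFG, hmp.integral_comp (MeasurableEquiv.measurableEmbedding _) G,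
      integral_prod _ hGint]
    have hbound : ∀ y, ∫ x, G (y, x) ∂(Measure.pi fun _ : Fin N => ν) ≤ N * D + δ y := by
      intro y
      obtain ⟨hpd, htr'⟩ := hstep y
      set M' := M + δ y • (1 : Matrix (Fin n) (Fin n) ℝ) - σ • Matrix.vecMulVec y.ofLp y.ofLp
      have hGy : ∀ x, G (y, x) =
          topEig (σ • ∑ i, Matrix.vecMulVec (x i).ofLp (x i).ofLp - M') + δ y := fun x => by
        rw [← topEig_add_smul_one]
        simp only [hG, M']
        congr 1
        rw [smul_add]
        abel
      simp_rw [hGy]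
      rw [integral_add (integrable_topEig hν N σ M') (integrable_const _)]
      simpa using ih M' hpd htr'
    calc _ ≤ ∫ y, (N * D + δ y) ∂ν :=
          integral_mono hGint.integral_prod_left ((integrable_const _).add hδ) hbound
      _ = N * D + ∫ y, δ y ∂ν := by
          rw [integral_add (integrable_const _) hδ]; simp
      _ ≤ _ := by push_cast; linarith

end Induction

/-- A square-integrable isotropic law on `ℝⁿ` whose marginals on coordinate subspaces (of any
orthonormal basis) have uniformly controlled excess over the level `t`. -/
structure RegularIsotropic {n : ℕ} (C η : ℝ) (ν : Measure (EuclideanSpace ℝ (Fin n))) : Prop where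
  memLp : MemLp id 2 ν
  integral_inner_sq : ∀ v, ∫ x, inner ℝ v x ^ 2 ∂ν = ‖v‖ ^ 2
  tail : ∀ (b : OrthonormalBasis (Fin n) ℝ (EuclideanSpace ℝ (Fin n))) (I : Finset (Fin n)) (t : ℝ),
    0 < t → C * (I.card : ℝ) ≤ t →
      ∫ x, max (∑ i ∈ I, inner ℝ (b i) x ^ 2 - t) 0 ∂ν ≤ C / η * t ^ (-η)

/-! ### The multiscale shift that keeps the resolvent sum small. -/

section Shift

variable {n : ℕ} {C η : ℝ} {ν : Measure (EuclideanSpace ℝ (Fin n))}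

theorem integrable_inner_sq (hν : MemLp id 2 ν) (v : EuclideanSpace ℝ (Fin n)) :
    Integrable (fun x => inner ℝ v x ^ 2) ν := by
  have h : MemLp (fun x => inner ℝ v x) 2 ν := by
    have := MemLp.const_inner (𝕜 := ℝ) v hν
    simpa using this
  exact h.integrable_sq

theorem integrable_sum_inner_sq (hν : MemLp id 2 ν)
    (b : OrthonormalBasis (Fin n) ℝ (EuclideanSpace ℝ (Fin n))) (I : Finset (Fin n)) :
    Integrable (fun x => ∑ i ∈ I, inner ℝ (b i) x ^ 2) ν :=
  integrable_finsetSum _ fun i _ => integrable_inner_sq hν (b i)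

theorem one_sub_two_rpow_ge {x : ℝ} (h0 : 0 ≤ x) (h1 : x ≤ 1) : x / 2 ≤ 1 - (2 : ℝ) ^ (-x) := by
  have h : (2 : ℝ) ^ (-x) = (1 + (-(1 / 2) : ℝ)) ^ x := by
    rw [Real.rpow_neg (by norm_num), ← Real.inv_rpow (by norm_num)]
    norm_num
  have := rpow_one_add_le_one_add_mul_self (s := (-(1 / 2) : ℝ)) (by norm_num) h0 h1
  rw [h]
  linarith

theorem one_sub_two_rpow_neg_ge {η : ℝ} (hη : 0 < η) : η / (2 * (1 + η)) ≤ 1 - (2 : ℝ) ^ (-η) := by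
  rcases le_or_gt η 1 with h | h
  · refine le_trans ?_ (one_sub_two_rpow_ge hη.le h)
    exact div_le_div_of_nonneg_left hη.le (by norm_num) (by linarith)
  · have h1 : (2 : ℝ) ^ (-η) ≤ (2 : ℝ) ^ (-1 : ℝ) :=
      Real.rpow_le_rpow_of_exponent_le (by norm_num) (by linarith)
    rw [Real.rpow_neg_one] at h1
    have : η / (2 * (1 + η)) ≤ 1 / 2 := by
      rw [div_le_div_iff₀ (by positivity) (by norm_num)]; linarith
    linarith

theorem geom_sum_range_le {r : ℝ} (h0 : 0 ≤ r) (h1 : r < 1) (K : ℕ) :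
    ∑ k ∈ Finset.range K, r ^ k ≤ 1 / (1 - r) := by
  rw [one_div, ← tsum_geometric_of_lt_one h0 h1]
  exact (summable_geometric_of_lt_one h0 h1).sum_le_tsum _ fun k _ => pow_nonneg h0 k

/-- This identity dictates the ratio r = 2^{-η/(1+η)}: the factor r^{-k(1+η)} = 2^{ηk} uses up half
of the decay 4^{-ηk}, and a geometric series of ratio 2^{-η} remains. -/
theorem level_weight_eq {η c φ : ℝ} (hη : 0 < η) (hc : 0 < c) (hφ : 0 < φ) (k : ℕ) :
    (c * ((2 : ℝ) ^ (-(η / (1 + η)))) ^ k)⁻¹ *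
        (c * ((2 : ℝ) ^ (-(η / (1 + η)))) ^ k * (4 ^ k / φ)) ^ (-η) =
      c⁻¹ ^ (1 + η) * φ ^ η * ((2 : ℝ) ^ (-η)) ^ k := by
  have h2 : (0 : ℝ) ≤ 2 := by norm_num
  have h4 : (4 : ℝ) ^ k = (2 : ℝ) ^ (2 * (k : ℝ)) := by
    rw [Real.rpow_mul h2, Real.rpow_natCast]; norm_num
  have hr : ((2 : ℝ) ^ (-(η / (1 + η)))) ^ k = (2 : ℝ) ^ (-(η / (1 + η)) * k) := by
    rw [Real.rpow_mul h2, Real.rpow_natCast]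
  have hr' : ((2 : ℝ) ^ (-η)) ^ k = (2 : ℝ) ^ (-η * k) := by
    rw [Real.rpow_mul h2, Real.rpow_natCast]
  rw [h4, hr, hr']
  have hφ' : (φ⁻¹) ^ (-η) = φ ^ η := by
    rw [Real.rpow_neg (by positivity), Real.inv_rpow hφ.le, inv_inv]
  rw [div_eq_mul_inv _ φ, ← mul_assoc, Real.mul_rpow (by positivity) (by positivity), hφ',
    mul_assoc c, ← Real.rpow_add (by norm_num), Real.mul_rpow hc.le (by positivity),
    ← Real.rpow_mul h2, mul_inv, ← Real.rpow_neg h2, Real.rpow_add (by positivity) 1 η,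
    Real.rpow_one, Real.inv_rpow hc.le, ← Real.rpow_neg hc.le]
  have : (2 : ℝ) ^ (-η * k) = (2 : ℝ) ^ (-(-(η / (1 + η)) * k)) *
      (2 : ℝ) ^ ((-(η / (1 + η)) * k + 2 * k) * -η) := by
    rw [← Real.rpow_add (by norm_num)]
    congr 1
    field_simp
    ring
  rw [this]
  ring

variable [IsProbabilityMeasure ν]

/-- Eigenvalues are grouped by powers of 4 relative to 1/φ. Group k receives a share s k of the
allowance τ, and Δ adds up the shifts needed to bring every group within its share. -/
theorem exists_shift_resolvent_le (hν : RegularIsotropic C η ν) (hC : 0 < C) (hη : 0 < η)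
    {φ τ : ℝ} (hφ : 0 < φ) (hτ : 0 < τ) (hCφ : 8 * C * φ ≤ τ) {μ : Fin n → ℝ}
    (hμ : ∀ i, 0 < μ i) (hμφ : ∑ i, 1 / μ i ≤ φ)
    (b : OrthonormalBasis (Fin n) ℝ (EuclideanSpace ℝ (Fin n))) :
    ∃ Δ : EuclideanSpace ℝ (Fin n) → ℝ, Integrable Δ ν ∧ (∀ x, 0 ≤ Δ x) ∧
      (∀ x δ, Δ x ≤ δ → ∑ i, inner ℝ (b i) x ^ 2 / (μ i + δ) ≤ τ) ∧
      ∫ x, Δ x ∂ν ≤ C / η * (4 * (1 + 1 / η) / τ) ^ (1 + η) * φ ^ η * (2 * (1 + 1 / η)) := by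
  -- The potential bound gives μ i * φ ≥ 1, so every eigenvalue has a level.
  have hlev : ∀ i, ∃ k : ℕ, (4 : ℝ) ^ k ≤ μ i * φ ∧ μ i * φ < 4 ^ (k + 1) := fun i => by
    refine exists_nat_pow_near ?_ (by norm_num)
    have h := (Finset.single_le_sum (f := fun i => 1 / μ i)
      (fun i _ => by have := hμ i; positivity) (Finset.mem_univ i)).trans hμφ
    rw [div_le_iff₀ (hμ i)] at h
    linarith
  choose ℓ hℓ1 hℓ2 using hlev
  set K := Finset.univ.sup ℓ + 1 with hK
  have hℓK : ∀ i ∈ (Finset.univ : Finset (Fin n)), ℓ i ∈ Finset.range K := fun i _ =>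
    Finset.mem_range.2 (Nat.lt_succ_of_le (Finset.le_sup (Finset.mem_univ i)))
  set I : ℕ → Finset (Fin n) := fun k => Finset.univ.filter fun i => ℓ i = k with hI
  set h : ℝ := 1 + 1 / η with hh
  have hh0 : 0 < h := by positivity
  set r : ℝ := (2 : ℝ) ^ (-(η / (1 + η))) with hr
  have hr0 : 0 < r := by positivity
  set c : ℝ := τ / (4 * h) with hc
  have hc0 : 0 < c := by positivity
  have hrh : 1 / (2 * h) ≤ 1 - r := by
    refine le_trans (le_of_eq ?_) (one_sub_two_rpow_ge (x := η / (1 + η)) (by positivity) ?_)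
    · rw [hh]; field_simp; ring
    · rw [div_le_one (by positivity)]; linarith
  have hr1 : r < 1 := by
    have : 0 < 1 / (2 * h) := by positivity
    linarith
  set p : ℕ → ℝ := fun k => c * r ^ k with hp
  have hp0 : ∀ k, 0 < p k := fun k => by positivity
  -- The first summand lifts the threshold s k * 4^k / φ to C |I k|, where the tail bound starts to
  -- apply; the second keeps the expected excesses summable. Each summand uses at most τ / 2 in
  -- total.
  set s : ℕ → ℝ := fun k => C * φ * (I k).card / 4 ^ k + p k with hs
  have hps : ∀ k, p k ≤ s k := fun k => by
    have : 0 ≤ C * φ * (I k).card / 4 ^ k := by positivity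
    simp only [hs]; linarith
  have hs0 : ∀ k, 0 < s k := fun k => (hp0 k).trans_le (hps k)
  have hsum : ∑ k ∈ Finset.range K, s k ≤ τ := by
    have h1 : ∑ k ∈ Finset.range K, p k ≤ τ / 2 := by
      rw [← Finset.mul_sum]
      calc c * ∑ k ∈ Finset.range K, r ^ k ≤ c * (1 / (1 - r)) := by
            gcongr; exact geom_sum_range_le hr0.le hr1 K
        _ ≤ c * (1 / (1 / (2 * h))) := by gcongr
        _ = τ / 2 := by rw [hc]; field_simp; norm_num
    have h2 : ∑ k ∈ Finset.range K, ((I k).card : ℝ) / 4 ^ k ≤ 4 := by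
      have : ∑ k ∈ Finset.range K, ((I k).card : ℝ) / 4 ^ k = ∑ i, (1 : ℝ) / 4 ^ ℓ i := by
        rw [← Finset.sum_fiberwise_of_maps_to hℓK]
        refine Finset.sum_congr rfl fun k _ => ?_
        rw [Finset.sum_congr rfl (g := fun _ => (1 : ℝ) / 4 ^ k)
          (fun i hi => by rw [(Finset.mem_filter.1 hi).2]), Finset.sum_const, nsmul_eq_mul]
        ring
      rw [this]
      calc ∑ i, (1 : ℝ) / 4 ^ ℓ i ≤ ∑ i, 4 / φ * (1 / μ i) := by
            refine Finset.sum_le_sum fun i _ => ?_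
            have h3 := hℓ2 i
            have := hμ i
            rw [pow_succ] at h3
            rw [div_mul_div_comm, mul_one, div_le_div_iff₀ (by positivity) (by positivity)]
            nlinarith
        _ ≤ 4 / φ * φ := by rw [← Finset.mul_sum]; gcongr
        _ = 4 := by field_simp
    calc ∑ k ∈ Finset.range K, s k
        = C * φ * ∑ k ∈ Finset.range K, ((I k).card : ℝ) / 4 ^ k + ∑ k ∈ Finset.range K, p k := by
          rw [Finset.mul_sum, ← Finset.sum_add_distrib]
          exact Finset.sum_congr rfl fun k _ => by simp only [hs]; ring
      _ ≤ C * φ * 4 + τ / 2 := by gcongr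
      _ ≤ τ := by linarith
  set S : ℕ → EuclideanSpace ℝ (Fin n) → ℝ := fun k x => ∑ i ∈ I k, inner ℝ (b i) x ^ 2 with hS
  -- Every δ ≥ T k x satisfies S k x / (4^k / φ + δ) ≤ s k, which bounds the contribution of group
  -- k.
  set T : ℕ → EuclideanSpace ℝ (Fin n) → ℝ := fun k x => max (S k x / s k - 4 ^ k / φ) 0 with hT
  have hTeq : ∀ k x, T k x = (s k)⁻¹ * max (S k x - s k * (4 ^ k / φ)) 0 := fun k x => by
    rw [mul_max_of_nonneg _ _ (inv_nonneg.2 (hs0 k).le), mul_zero]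
    simp only [hT]
    congr 1
    have := (hs0 k).ne'
    field_simp
  have hTint : ∀ k, Integrable (T k) ν := fun k => by
    refine Integrable.sup (((integrable_sum_inner_sq hν.memLp b (I k)).div_const (s k)).sub
      (integrable_const _)) (integrable_const 0)
  refine ⟨fun x => ∑ k ∈ Finset.range K, T k x, integrable_finsetSum _ fun k _ => hTint k,
    fun x => Finset.sum_nonneg fun k _ => le_max_right _ _, fun x δ hδ => ?_, ?_⟩
  · have hδ0 : 0 ≤ δ := le_trans (Finset.sum_nonneg fun k _ => le_max_right _ _) hδ
    rw [← Finset.sum_fiberwise_of_maps_to hℓK]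
    refine (Finset.sum_le_sum fun k hk => ?_).trans hsum
    have hTk : S k x / s k - 4 ^ k / φ ≤ δ :=
      (le_max_left _ 0).trans ((Finset.single_le_sum (f := fun k => T k x)
        (fun k _ => le_max_right _ _) hk).trans hδ)
    have hpos : 0 < 4 ^ k / φ + δ := by positivity
    have hSk : S k x ≤ s k * (4 ^ k / φ + δ) := by
      have : S k x / s k ≤ 4 ^ k / φ + δ := by linarith
      rw [div_le_iff₀ (hs0 k)] at this
      linarith
    calc ∑ i ∈ Finset.univ.filter (fun i => ℓ i = k), inner ℝ (b i) x ^ 2 / (μ i + δ)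
        ≤ ∑ i ∈ I k, inner ℝ (b i) x ^ 2 / (4 ^ k / φ + δ) := by
          refine Finset.sum_le_sum fun i hi => ?_
          refine div_le_div_of_nonneg_left (sq_nonneg _) hpos ?_
          have h3 := hℓ1 i
          rw [(Finset.mem_filter.1 hi).2, ← div_le_iff₀ hφ] at h3
          linarith
      _ = S k x / (4 ^ k / φ + δ) := by rw [← Finset.sum_div]
      _ ≤ s k := by rwa [div_le_iff₀ hpos]
  · have hTle : ∀ k, ∫ x, T k x ∂ν ≤ C / η * (c⁻¹ ^ (1 + η) * φ ^ η * ((2 : ℝ) ^ (-η)) ^ k) := by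
      intro k
      simp_rw [hTeq]
      rw [integral_const_mul]
      have htail := hν.tail b (I k) (s k * (4 ^ k / φ)) (by have := hs0 k; positivity) (by
        calc C * ((I k).card : ℝ) = C * φ * (I k).card / 4 ^ k * (4 ^ k / φ) := by field_simp
          _ ≤ s k * (4 ^ k / φ) := by
            gcongr
            have := (hp0 k).le
            simp only [hs]; linarith)
      rw [← level_weight_eq hη hc0 hφ k]
      calc (s k)⁻¹ * ∫ x, max (S k x - s k * (4 ^ k / φ)) 0 ∂ν
          ≤ (s k)⁻¹ * (C / η * (s k * (4 ^ k / φ)) ^ (-η)) := by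
            have := hs0 k
            gcongr
        _ ≤ (p k)⁻¹ * (C / η * (p k * (4 ^ k / φ)) ^ (-η)) := by
            have h1 := hp0 k
            have h2 := hs0 k
            have h3 : (s k * (4 ^ k / φ)) ^ (-η) ≤ (p k * (4 ^ k / φ)) ^ (-η) := by
              refine Real.rpow_le_rpow_of_nonpos (by positivity) ?_ (by linarith)
              have := hps k
              gcongr
            have h4 : (s k)⁻¹ ≤ (p k)⁻¹ := inv_anti₀ h1 (hps k)
            gcongr
        _ = _ := by ring
    rw [integral_finsetSum _ fun k _ => hTint k]
    have hg0 : (0 : ℝ) < 2 ^ (-η) := by positivity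
    have hgh : 1 / (2 * h) ≤ 1 - (2 : ℝ) ^ (-η) := by
      refine le_trans (le_of_eq ?_) (one_sub_two_rpow_neg_ge hη)
      rw [hh]; field_simp; ring
    have hg1 : (2 : ℝ) ^ (-η) < 1 := by
      have : 0 < 1 / (2 * h) := by positivity
      linarith
    have hcinv : c⁻¹ = 4 * h / τ := by rw [hc, inv_div]
    calc ∑ k ∈ Finset.range K, ∫ x, T k x ∂ν
        ≤ ∑ k ∈ Finset.range K, C / η * (c⁻¹ ^ (1 + η) * φ ^ η * ((2 : ℝ) ^ (-η)) ^ k) :=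
          Finset.sum_le_sum fun k _ => hTle k
      _ = C / η * (4 * h / τ) ^ (1 + η) * φ ^ η * ∑ k ∈ Finset.range K, ((2 : ℝ) ^ (-η)) ^ k := by
          rw [Finset.mul_sum, hcinv]
          exact Finset.sum_congr rfl fun k _ => by ring
      _ ≤ C / η * (4 * h / τ) ^ (1 + η) * φ ^ η * (2 * h) := by
          gcongr
          refine (geom_sum_range_le hg0.le hg1 K).trans ?_
          rw [div_le_iff₀ (by linarith)]
          calc 1 = 2 * h * (1 / (2 * h)) := by field_simp
            _ ≤ _ := by gcongr

end Shift

/-! ### One step of the upper and of the lower barrier. -/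

section Steps

/-- Convexity of the positive part; missing mass in w only helps, because t ≥ 0. -/
theorem sum_mul_sub_pos_le {n : ℕ} {w ξ : Fin n → ℝ} {t : ℝ} (ht : 0 ≤ t) (hw : ∀ i, 0 ≤ w i)
    (hw1 : ∑ i, w i ≤ 1) :
    max (∑ i, w i * ξ i - t) 0 ≤ ∑ i, w i * max (ξ i - t) 0 := by
  refine max_le ?_ (Finset.sum_nonneg fun i _ => mul_nonneg (hw i) (le_max_right _ _))
  calc ∑ i, w i * ξ i - t ≤ ∑ i, w i * ξ i - (∑ i, w i) * t := by nlinarith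
    _ = ∑ i, w i * (ξ i - t) := by
      rw [Finset.sum_mul, ← Finset.sum_sub_distrib]
      exact Finset.sum_congr rfl fun i _ => by ring
    _ ≤ _ := Finset.sum_le_sum fun i _ => mul_le_mul_of_nonneg_left (le_max_left _ _) (hw i)

variable {n : ℕ} {C η : ℝ} {ν : Measure (EuclideanSpace ℝ (Fin n))}

theorem integral_sum_mul_inner_sq (hν : RegularIsotropic C η ν)
    (b : OrthonormalBasis (Fin n) ℝ (EuclideanSpace ℝ (Fin n))) (w : Fin n → ℝ) :
    ∫ x, ∑ i, w i * inner ℝ (b i) x ^ 2 ∂ν = ∑ i, w i := by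
  rw [integral_finsetSum _ fun i _ => (integrable_inner_sq hν.memLp (b i)).const_mul (w i)]
  refine Finset.sum_congr rfl fun i _ => ?_
  rw [integral_const_mul, hν.integral_inner_sq, b.norm_eq_one]
  ring

theorem integrable_sum_mul_inner_sq (hν : MemLp id 2 ν)
    (b : OrthonormalBasis (Fin n) ℝ (EuclideanSpace ℝ (Fin n))) (w : Fin n → ℝ) :
    Integrable (fun x => ∑ i, w i * inner ℝ (b i) x ^ 2) ν :=
  integrable_finsetSum _ fun i _ => (integrable_inner_sq hν (b i)).const_mul (w i)

theorem sum_sq_div_eq {μ ξ : Fin n → ℝ} :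
    (∑ i, ξ i / μ i ^ 2) / ∑ i, 1 / μ i ^ 2 =
      ∑ i, (1 / μ i ^ 2 / ∑ j, 1 / μ j ^ 2) * ξ i := by
  rw [Finset.sum_div]
  exact Finset.sum_congr rfl fun i _ => by ring

theorem sum_normalized_weights [NeZero n] {μ : Fin n → ℝ} (hμ : ∀ i, 0 < μ i) :
    ∑ i, (1 / μ i ^ 2 / ∑ j, 1 / μ j ^ 2) = 1 := by
  rw [← Finset.sum_div]
  refine div_self (Finset.sum_pos (fun i _ => ?_) Finset.univ_nonempty).ne'
  have := hμ i
  positivity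

variable [IsProbabilityMeasure ν] [NeZero n]

/-- The two conditions of `barrier_up` are met by adding two nonnegative shifts: Δ for the resolvent
sum, and a multiple of the weighted average g, whose mean is 1 by isotropy. -/
theorem exists_upper_shift (hν : RegularIsotropic C η ν) (hC : 0 < C) (hη : 0 < η)
    {φ κ : ℝ} (hφ : 0 < φ) (hκ : 0 < κ) (hCφ : 8 * C * φ ≤ κ / (1 + 2 * κ))
    {M : Matrix (Fin n) (Fin n) ℝ} (hM : M.PosDef) (htr : M⁻¹.trace ≤ φ) :
    ∃ δ : EuclideanSpace ℝ (Fin n) → ℝ, Integrable δ ν ∧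
      ∫ x, δ x ∂ν ≤ (1 + 2 * κ) * (1 + κ) +
        C / η * (4 * (1 + 1 / η) / (κ / (1 + 2 * κ))) ^ (1 + η) * φ ^ η * (2 * (1 + 1 / η)) ∧
      ∀ x, (M + δ x • (1 : Matrix (Fin n) (Fin n) ℝ)
          - (1 : ℝ) • Matrix.vecMulVec x.ofLp x.ofLp).PosDef ∧
        (M + δ x • (1 : Matrix (Fin n) (Fin n) ℝ)
          - (1 : ℝ) • Matrix.vecMulVec x.ofLp x.ofLp)⁻¹.trace ≤ φ := by
  rw [trace_inv_eq_sum hM] at htr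
  have hH := hM.isHermitian
  set b := hH.eigenvectorBasis
  set μ := hH.eigenvalues
  have hμ : ∀ i, 0 < μ i := hM.eigenvalues_pos
  have hτ : 0 < κ / (1 + 2 * κ) := by positivity
  obtain ⟨Δ, hΔint, hΔ0, hΔ, hΔB⟩ := exists_shift_resolvent_le hν hC hη hφ hτ hCφ hμ htr b
  set w : Fin n → ℝ := fun i => 1 / μ i ^ 2 / ∑ j, 1 / μ j ^ 2
  set g : EuclideanSpace ℝ (Fin n) → ℝ := fun x => ∑ i, w i * inner ℝ (b i) x ^ 2
  have hgint : Integrable g ν := integrable_sum_mul_inner_sq hν.memLp b w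
  have hg1 : ∫ x, g x ∂ν = 1 :=
    (integral_sum_mul_inner_sq hν b w).trans (sum_normalized_weights hμ)
  have hg0 : ∀ x, 0 ≤ g x := fun x => Finset.sum_nonneg fun i _ =>
    mul_nonneg (div_nonneg (by positivity) (Finset.sum_nonneg fun j _ => by positivity))
      (sq_nonneg _)
  refine ⟨fun x => Δ x + (1 + 2 * κ) * (1 + κ) * g x, hΔint.add (hgint.const_mul _), ?_,
    fun x => ?_⟩
  · rw [integral_add hΔint (hgint.const_mul _), integral_const_mul, hg1]
    linarith
  · set δ := Δ x + (1 + 2 * κ) * (1 + κ) * g x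
    have hgx : 0 ≤ (1 + 2 * κ) * (1 + κ) * g x := mul_nonneg (by positivity) (hg0 x)
    have hδ0 : 0 ≤ δ := add_nonneg (hΔ0 x) hgx
    have hq1 := hΔ x δ (by linarith)
    have hτ1 : κ / (1 + 2 * κ) < 1 := by rw [div_lt_one (by positivity)]; linarith
    obtain ⟨hpd, htr'⟩ := posDef_shift_sub_vecMulVec hH (δ := δ) (σ := 1) x
      (fun i => add_pos_of_pos_of_nonneg (hμ i) hδ0) (by rw [one_mul]; linarith)
    refine ⟨hpd, ?_⟩
    rw [htr', one_mul, one_mul]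
    refine (barrier_up hμ (fun i => sq_nonneg (inner ℝ (b i) x)) hδ0 hκ hq1 ?_).trans htr
    rw [sum_sq_div_eq]
    change _ * g x ≤ δ
    linarith [hΔ0 x]


/-- The larger of y and z exceeds T, hence is at most twice its excess over T / 2. -/
theorem le_two_mul_pos_add_pos {y z T : ℝ} (hT : 0 ≤ T) (hz : T < z) :
    y ≤ 2 * max (y - T / 2) 0 + 2 * max (z - T / 2) 0 := by
  have h1 := le_max_left (y - T / 2) 0
  have h2 := le_max_right (y - T / 2) 0
  have h3 := le_max_left (z - T / 2) 0
  rcases le_or_gt y z with h | h <;> linarith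

/-- The barrier moves only on A, where the resolvent sum is at most τ; elsewhere it rests, and
adding x xᵀ can only lower the potential. The price is the mean of g off A. As g and q average
squared coordinates with total weight at most 1, one-dimensional tails bound it. -/
theorem exists_lower_shift (hν : RegularIsotropic C η ν) (hC : 0 < C) (hη : 0 < η)
    {φ τ : ℝ} (hφ : 0 < φ) (hτ : 0 < τ) (hτ1 : τ < 1) (hCφ : 8 * C * φ ≤ τ)
    {M : Matrix (Fin n) (Fin n) ℝ} (hM : M.PosDef) (htr : M⁻¹.trace ≤ φ) :
    ∃ δ : EuclideanSpace ℝ (Fin n) → ℝ, Integrable δ ν ∧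
      ∫ x, δ x ∂ν ≤ -(1 - τ) ^ 3 + 4 * (C / η * (τ / φ / 2) ^ (-η)) ∧
      ∀ x, (M + δ x • (1 : Matrix (Fin n) (Fin n) ℝ)
          - (-1 : ℝ) • Matrix.vecMulVec x.ofLp x.ofLp).PosDef ∧
        (M + δ x • (1 : Matrix (Fin n) (Fin n) ℝ)
          - (-1 : ℝ) • Matrix.vecMulVec x.ofLp x.ofLp)⁻¹.trace ≤ φ := by
  rw [trace_inv_eq_sum hM] at htr
  have hH := hM.isHermitian
  set b := hH.eigenvectorBasis
  set μ := hH.eigenvalues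
  have hμ : ∀ i, 0 < μ i := hM.eigenvalues_pos
  set w : Fin n → ℝ := fun i => 1 / μ i ^ 2 / ∑ j, 1 / μ j ^ 2
  have hw0 : ∀ i, 0 ≤ w i := fun i =>
    div_nonneg (by positivity) (Finset.sum_nonneg fun j _ => by positivity)
  have hw1 : ∑ i, w i = 1 := sum_normalized_weights hμ
  set w' : Fin n → ℝ := fun i => 1 / μ i / φ
  have hw'0 : ∀ i, 0 ≤ w' i := fun i => by have := hμ i; positivity
  have hw'1 : ∑ i, w' i ≤ 1 := by rw [← Finset.sum_div, div_le_one hφ]; exact htr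
  set g : EuclideanSpace ℝ (Fin n) → ℝ := fun x => ∑ i, w i * inner ℝ (b i) x ^ 2
  set q : EuclideanSpace ℝ (Fin n) → ℝ := fun x => ∑ i, w' i * inner ℝ (b i) x ^ 2
  have hgint : Integrable g ν := integrable_sum_mul_inner_sq hν.memLp b w
  have hg1 : ∫ x, g x ∂ν = 1 := (integral_sum_mul_inner_sq hν b w).trans hw1
  have hg0 : ∀ x, 0 ≤ g x := fun x => Finset.sum_nonneg fun i _ =>
    mul_nonneg (hw0 i) (sq_nonneg _)
  have hqm : Measurable q := by
    refine Continuous.measurable ?_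
    fun_prop
  set A : Set (EuclideanSpace ℝ (Fin n)) := {x | q x ≤ τ / φ} with hA
  have hAm : MeasurableSet A := measurableSet_le hqm measurable_const
  have hqeq : ∀ x, ∑ i, inner ℝ (b i) x ^ 2 / μ i = φ * q x := fun x => by
    rw [Finset.mul_sum]
    exact Finset.sum_congr rfl fun i _ => by simp only [w']; field_simp
  set δ : EuclideanSpace ℝ (Fin n) → ℝ := A.indicator fun x => -((1 - τ) ^ 3 * g x) with hδ
  have hδint : Integrable δ ν := ((hgint.const_mul _).neg).indicator hAm
  refine ⟨δ, hδint, ?_, fun x => ?_⟩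
  · set T := τ / φ
    have hT : 0 < T := by positivity
    have hCT : C ≤ T / 2 := by
      rw [le_div_iff₀ (by norm_num), le_div_iff₀ hφ]; nlinarith
    set m : Fin n → EuclideanSpace ℝ (Fin n) → ℝ := fun i x =>
      max (inner ℝ (b i) x ^ 2 - T / 2) 0
    have hmint : ∀ i, Integrable (m i) ν := fun i =>
      Integrable.sup ((integrable_inner_sq hν.memLp (b i)).sub (integrable_const _))
        (integrable_const 0)
    have hmle : ∀ i, ∫ x, m i x ∂ν ≤ C / η * (T / 2) ^ (-η) := fun i => by
      simpa using hν.tail b {i} (T / 2) (by positivity) (by simpa using hCT)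
    have hρ : 0 ≤ C / η * (T / 2) ^ (-η) := by positivity
    have hsumint : ∀ u : Fin n → ℝ, Integrable (fun x => ∑ i, u i * m i x) ν := fun u =>
      integrable_finsetSum _ fun i _ => (hmint i).const_mul _
    have hsumle : ∀ u : Fin n → ℝ, (∀ i, 0 ≤ u i) → ∑ i, u i ≤ 1 →
        ∫ x, ∑ i, u i * m i x ∂ν ≤ C / η * (T / 2) ^ (-η) := fun u hu hu1 => by
      rw [integral_finsetSum _ fun i _ => (hmint i).const_mul (u i)]
      calc ∑ i, ∫ x, u i * m i x ∂ν ≤ ∑ i, u i * (C / η * (T / 2) ^ (-η)) := by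
            refine Finset.sum_le_sum fun i _ => ?_
            rw [integral_const_mul]
            exact mul_le_mul_of_nonneg_left (hmle i) (hu i)
        _ ≤ _ := by
            rw [← Finset.sum_mul]
            exact mul_le_of_le_one_left hρ hu1
    have hpt : ∀ x, δ x ≤ -((1 - τ) ^ 3 * g x) +
        (2 * ∑ i, w i * m i x + 2 * ∑ i, w' i * m i x) := fun x => by
      have e1 := sum_mul_sub_pos_le (ξ := fun i => inner ℝ (b i) x ^ 2) (t := T / 2)
        (by positivity) hw0 hw1.le
      have e2 := sum_mul_sub_pos_le (ξ := fun i => inner ℝ (b i) x ^ 2) (t := T / 2)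
        (by positivity) hw'0 hw'1
      change max (g x - T / 2) 0 ≤ ∑ i, w i * m i x at e1
      change max (q x - T / 2) 0 ≤ ∑ i, w' i * m i x at e2
      by_cases hx : x ∈ A
      · rw [hδ, Set.indicator_of_mem hx]
        linarith [le_max_right (g x - T / 2) 0, le_max_right (q x - T / 2) 0]
      · rw [hδ, Set.indicator_of_notMem hx]
        have hqx : T < q x := not_le.1 hx
        have h3 := le_two_mul_pos_add_pos (y := g x) hT.le hqx
        have h4 : (1 - τ) ^ 3 ≤ 1 := pow_le_one₀ (by linarith) (by linarith)
        nlinarith [hg0 x]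
    have i1 : Integrable (fun x => -((1 - τ) ^ 3 * g x)) ν := (hgint.const_mul _).neg
    have i2 : Integrable (fun x => 2 * ∑ i, w i * m i x) ν := (hsumint w).const_mul 2
    have i3 : Integrable (fun x => 2 * ∑ i, w' i * m i x) ν := (hsumint w').const_mul 2
    refine (integral_mono hδint (i1.add (i2.add i3)) hpt).trans ?_
    have e : ∫ x, (-((1 - τ) ^ 3 * g x) + (2 * ∑ i, w i * m i x + 2 * ∑ i, w' i * m i x)) ∂ν
        = -(1 - τ) ^ 3 + (2 * ∫ x, ∑ i, w i * m i x ∂ν + 2 * ∫ x, ∑ i, w' i * m i x ∂ν) := by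
      have e23 := integral_add i2 i3
      have e123 := integral_add i1 (i2.add i3)
      simp only [Pi.add_apply] at e123
      rw [e123, e23, integral_neg, integral_const_mul, integral_const_mul, integral_const_mul, hg1,
        mul_one]
    refine (le_of_eq e).trans ?_
    linarith [hsumle w hw0 hw1.le, hsumle w' hw'0 hw'1]
  · have hξ0 : ∀ i, 0 ≤ inner ℝ (b i) x ^ 2 := fun i => sq_nonneg _
    by_cases hx : x ∈ A
    · have hq : ∑ i, inner ℝ (b i) x ^ 2 / μ i ≤ τ := by
        rw [hqeq]
        have : q x ≤ τ / φ := hx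
        rw [le_div_iff₀ hφ] at this
        linarith
      obtain ⟨hp, hle⟩ := barrier_low hμ hξ0 hτ hτ1 hq rfl
      rw [sum_sq_div_eq] at hp hle
      have hδx : δ x = -((1 - τ) ^ 3 * g x) := by rw [hδ, Set.indicator_of_mem hx]
      change ∀ i, 0 < μ i - (1 - τ) ^ 3 * g x at hp
      simp only [sub_eq_add_neg (μ _)] at hp hle
      change _ + -(_ / (1 + ∑ i, inner ℝ (b i) x ^ 2 / (μ i + -((1 - τ) ^ 3 * g x)))) ≤ _ at hle
      rw [hδx]
      have hq1 : 0 ≤ ∑ i, inner ℝ (b i) x ^ 2 / (μ i + -((1 - τ) ^ 3 * g x)) :=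
        Finset.sum_nonneg fun i _ => div_nonneg (hξ0 i) (hp i).le
      obtain ⟨hpd, htr'⟩ := posDef_shift_sub_vecMulVec hH (δ := -((1 - τ) ^ 3 * g x)) (σ := -1) x
        hp (by linarith)
      refine ⟨hpd, ?_⟩
      rw [htr', neg_one_mul, neg_one_mul, sub_neg_eq_add, neg_div]
      exact hle.trans htr
    · have hδx : δ x = 0 := by rw [hδ, Set.indicator_of_notMem hx]
      rw [hδx]
      have hq1 : 0 ≤ ∑ i, inner ℝ (b i) x ^ 2 / (μ i + 0) :=
        Finset.sum_nonneg fun i _ => div_nonneg (hξ0 i) (by simpa using (hμ i).le)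
      obtain ⟨hpd, htr'⟩ := posDef_shift_sub_vecMulVec hH (δ := 0) (σ := -1) x
        (fun i => by simpa using hμ i) (by linarith)
      refine ⟨hpd, ?_⟩
      rw [htr', neg_one_mul, neg_one_mul, sub_neg_eq_add, neg_div]
      have hq2 : 0 ≤ (∑ i, inner ℝ (b i) x ^ 2 / (μ i + 0) ^ 2) /
          (1 + ∑ i, inner ℝ (b i) x ^ 2 / (μ i + 0)) :=
        div_nonneg (Finset.sum_nonneg fun i _ => div_nonneg (hξ0 i) (sq_nonneg _)) (by linarith)
      simp only [add_zero] at hq2 ⊢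
      linarith

end Steps

/-! ### Mean deviation of a scalar average. -/

section Deviation

/-- The excess of f over T enters twice, through the sample and through the mean. The truncated part
Y has variance at most T, since Y² ≤ T Y and Y has mean at most 1, and |z| ≤ a/2 + z²/(2a) turns
this into a bound in L¹. -/
theorem integral_abs_mean_sub_one_le {E : Type*} [MeasurableSpace E] {ν : Measure E}
    [IsProbabilityMeasure ν] {f : E → ℝ} (hf : Integrable f ν) (hf0 : ∀ x, 0 ≤ f x)
    (hf1 : ∫ x, f x ∂ν = 1) {T a : ℝ} (hT : 0 < T) (ha : 0 < a) {N : ℕ} (hN : 0 < N) :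
    ∫ x : Fin N → E, |1 / (N : ℝ) * ∑ i, f (x i) - 1| ∂(Measure.pi fun _ => ν) ≤
      2 * ∫ x, max (f x - T) 0 ∂ν + (a / 2 + T / N / (2 * a)) := by
  have hN' : (0 : ℝ) < N := by exact_mod_cast hN
  set R : E → ℝ := fun x => max (f x - T) 0
  set Y : E → ℝ := fun x => min (f x) T
  have hfYR : ∀ x, f x = Y x + R x := fun x => by
    simp only [Y, R]
    rcases le_total (f x) T with h | h
    · rw [min_eq_left h, max_eq_right (by linarith)]; ring
    · rw [min_eq_right h, max_eq_left (by linarith)]; ring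
  have hR : Integrable R ν := (hf.sub (integrable_const T)).sup (integrable_const 0)
  have hY : Integrable Y ν := hf.inf (integrable_const T)
  have hR0 : ∀ x, 0 ≤ R x := fun x => le_max_right _ _
  have hY0 : ∀ x, 0 ≤ Y x := fun x => le_min (hf0 x) hT.le
  have hYT : ∀ x, Y x ≤ T := fun x => min_le_right _ _
  have hsum1 : ∫ x, Y x ∂ν + ∫ x, R x ∂ν = 1 := by
    rw [← integral_add hY hR, ← hf1]
    exact integral_congr_ae (Filter.Eventually.of_forall fun x => (hfYR x).symm)
  have hYL : MemLp Y 2 ν := MemLp.of_bound hY.aestronglyMeasurable T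
    (Filter.Eventually.of_forall fun x => by
      rw [Real.norm_eq_abs, abs_of_nonneg (hY0 x)]; exact hYT x)
  have hvarY : Var[Y; ν] ≤ T := by
    refine (variance_le_expectation_sq hY.aestronglyMeasurable).trans ?_
    have hle : ∫ x, (Y ^ 2) x ∂ν ≤ ∫ x, T * Y x ∂ν := by
      refine integral_mono hYL.integrable_sq (hY.const_mul T) fun x => ?_
      simp only [Pi.pow_apply]
      nlinarith [hY0 x, hYT x]
    refine hle.trans ?_
    rw [integral_const_mul]
    have : 0 ≤ ∫ x, R x ∂ν := integral_nonneg hR0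
    nlinarith
  set W : (Fin N → E) → ℝ := fun x => 1 / (N : ℝ) * ∑ i, Y (x i) with hW
  have hYi : ∀ i : Fin N, Integrable (fun x : Fin N → E => Y (x i)) (Measure.pi fun _ => ν) :=
    fun i => integrable_comp_eval (μ := fun _ : Fin N => ν) hY
  have hRi : ∀ i : Fin N, Integrable (fun x : Fin N → E => R (x i)) (Measure.pi fun _ => ν) :=
    fun i => integrable_comp_eval (μ := fun _ : Fin N => ν) hR
  have hmean : ∀ (g : E → ℝ), Integrable g ν → ∫ x : Fin N → E, 1 / (N : ℝ) * ∑ i, g (x i)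
      ∂(Measure.pi fun _ => ν) = ∫ x, g x ∂ν := fun g hg => by
    rw [integral_const_mul, integral_finsetSum _ fun i _ =>
      integrable_comp_eval (μ := fun _ : Fin N => ν) (i := i) hg]
    have : ∀ i : Fin N, ∫ x : Fin N → E, g (x i) ∂(Measure.pi fun _ => ν) = ∫ x, g x ∂ν := fun i =>
      integral_comp_eval (μ := fun _ : Fin N => ν) (i := i) hg.aestronglyMeasurable
    simp_rw [this]
    simp
    field_simp
  have hWint : Integrable W (Measure.pi fun _ => ν) :=
    (integrable_finsetSum _ fun i _ => hYi i).const_mul _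
  have hWL : MemLp W 2 (Measure.pi fun _ => ν) := by
    refine MemLp.of_bound hWint.aestronglyMeasurable T (Filter.Eventually.of_forall fun x => ?_)
    have h0 : 0 ≤ W x := mul_nonneg (by positivity) (Finset.sum_nonneg fun i _ => hY0 _)
    rw [Real.norm_eq_abs, abs_of_nonneg h0]
    calc W x ≤ 1 / (N : ℝ) * ∑ i : Fin N, T := by
          simp only [hW]; gcongr; exact hYT _
      _ = T := by simp; field_simp
  have hWvar : ∫ x, (W x - ∫ y, Y y ∂ν) ^ 2 ∂(Measure.pi fun _ : Fin N => ν) ≤ T / N := by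
    have e1 : ∫ x, (W x - ∫ y, Y y ∂ν) ^ 2 ∂(Measure.pi fun _ : Fin N => ν)
        = Var[W; Measure.pi fun _ : Fin N => ν] := by
      rw [variance_eq_integral hWint.aemeasurable, hmean Y hY]
    have e2 : Var[W; Measure.pi fun _ : Fin N => ν] = (1 / (N : ℝ)) ^ 2 * (N * Var[Y; ν]) := by
      rw [hW, variance_const_mul]
      have := variance_sum_pi (μ := fun _ : Fin N => ν) (X := fun _ => Y) (fun _ => hYL)
      have hfun : (∑ i, fun ω : Fin N → E => Y (ω i)) = fun x => ∑ i, Y (x i) := by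
        ext x; simp
      rw [hfun] at this
      rw [this]
      simp
    rw [e1, e2]
    calc (1 / (N : ℝ)) ^ 2 * (N * Var[Y; ν]) = Var[Y; ν] / N := by field_simp
      _ ≤ T / N := by gcongr
  have hpt : ∀ x : Fin N → E, |1 / (N : ℝ) * ∑ i, f (x i) - 1| ≤
      1 / (N : ℝ) * ∑ i, R (x i) + (∫ y, R y ∂ν + (a / 2 +
        1 / (2 * a) * (W x - ∫ y, Y y ∂ν) ^ 2)) := fun x => by
    have e : 1 / (N : ℝ) * ∑ i, f (x i) - 1 =
        1 / (N : ℝ) * ∑ i, R (x i) - ∫ y, R y ∂ν + (W x - ∫ y, Y y ∂ν) := by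
      simp_rw [hfYR, Finset.sum_add_distrib]
      simp only [hW]
      linarith
    rw [e]
    have h1 : 0 ≤ 1 / (N : ℝ) * ∑ i, R (x i) :=
      mul_nonneg (by positivity) (Finset.sum_nonneg fun i _ => hR0 _)
    have h2 : 0 ≤ ∫ y, R y ∂ν := integral_nonneg hR0
    set z := W x - ∫ y, Y y ∂ν
    have h3 : |z| ≤ a / 2 + 1 / (2 * a) * z ^ 2 := by
      have : a / 2 + 1 / (2 * a) * z ^ 2 - |z| = 1 / (2 * a) * (|z| - a) ^ 2 := by
        rw [← sq_abs z]; field_simp; ring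
      have : 0 ≤ 1 / (2 * a) * (|z| - a) ^ 2 := by positivity
      linarith
    have h4 := abs_le.1 h3
    rw [abs_le]
    constructor <;> linarith [h4.1, h4.2]
  have i1 : Integrable (fun x : Fin N → E => 1 / (N : ℝ) * ∑ i, R (x i)) (Measure.pi fun _ => ν) :=
    (integrable_finsetSum _ fun i _ => hRi i).const_mul _
  have i2 : Integrable (fun x => 1 / (2 * a) * (W x - ∫ y, Y y ∂ν) ^ 2)
      (Measure.pi fun _ : Fin N => ν) :=
    ((hWL.sub (memLp_const _)).integrable_sq).const_mul _
  have i0 : Integrable (fun x : Fin N → E => |1 / (N : ℝ) * ∑ i, f (x i) - 1|)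
      (Measure.pi fun _ => ν) :=
    (((integrable_finsetSum _ fun i _ => integrable_comp_eval (μ := fun _ : Fin N => ν) hf).const_mul
      _).sub (integrable_const 1)).abs
  have i3 : Integrable (fun x => a / 2 + 1 / (2 * a) * (W x - ∫ y, Y y ∂ν) ^ 2)
      (Measure.pi fun _ : Fin N => ν) := (integrable_const _).add i2
  have i4 : Integrable (fun x => ∫ y, R y ∂ν + (a / 2 + 1 / (2 * a) * (W x - ∫ y, Y y ∂ν) ^ 2))
      (Measure.pi fun _ : Fin N => ν) := (integrable_const _).add i3
  refine (integral_mono i0 (i1.add i4) hpt).trans ?_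
  rw [integral_add' i1 i4, hmean R hR, integral_add (integrable_const _) i3,
    integral_add (integrable_const _) i2, integral_const_mul]
  simp only [integral_const, probReal_univ, one_smul]
  have : 1 / (2 * a) * ∫ x, (W x - ∫ y, Y y ∂ν) ^ 2 ∂(Measure.pi fun _ : Fin N => ν)
      ≤ T / N / (2 * a) := by
    calc _ ≤ 1 / (2 * a) * (T / N) := by gcongr
      _ = _ := by ring
  linarith

end Deviation

/-! ### Bookkeeping of constants. -/

section Numerics

theorem one_add_inv_rpow_le_three {η : ℝ} (hη : 0 < η) : (1 + 1 / η) ^ η ≤ 3 := by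
  have h1 : 1 + 1 / η ≤ Real.exp (1 / η) := by linarith [Real.add_one_le_exp (1 / η)]
  calc (1 + 1 / η) ^ η ≤ Real.exp (1 / η) ^ η := Real.rpow_le_rpow (by positivity) h1 hη.le
    _ = Real.exp 1 := by rw [← Real.exp_mul]; congr 1; field_simp
    _ ≤ 3 := Real.exp_one_lt_three.le

/-- The common error term of the two barrier arguments. -/
noncomputable def barrierError (C η φ τ : ℝ) : ℝ :=
  C / η * (4 * (1 + 1 / η) / τ) ^ (1 + η) * φ ^ η * (2 * (1 + 1 / η))

/-- Applied with c = 1 to the scalar deviation and with c = 2 to the lower barrier. -/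
theorem tail_le_barrierError {C η φ τ c : ℝ} (hC : 0 < C) (hη : 0 < η) (hφ : 0 < φ) (hτ : 0 < τ)
    (hτ1 : τ ≤ 1) (hc0 : 0 < c) (hc : c ≤ 4) :
    8 * (C / η * (τ / φ / c) ^ (-η)) ≤ barrierError C η φ τ := by
  have hh : 1 ≤ 1 + 1 / η := by have : 0 < 1 / η := by positivity
                                linarith
  set h := 1 + 1 / η
  have h1 : (τ / φ / c) ^ (-η) = (c / τ) ^ η * φ ^ η := by
    rw [Real.rpow_neg (by positivity), ← Real.inv_rpow (by positivity),
      ← Real.mul_rpow (by positivity) (by positivity)]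
    congr 1
    field_simp
  have h2 : (c / τ) ^ η ≤ (4 * h / τ) ^ η := by
    refine Real.rpow_le_rpow (by positivity) ?_ hη.le
    gcongr
    linarith
  have h3 : 4 ≤ 4 * h / τ := by rw [le_div_iff₀ hτ]; nlinarith
  have h4 : 8 ≤ (4 * h / τ) * (2 * h) := by nlinarith
  rw [h1, barrierError, Real.rpow_add (by positivity), Real.rpow_one]
  calc 8 * (C / η * ((c / τ) ^ η * φ ^ η))
      ≤ (4 * h / τ) * (2 * h) * (C / η * ((4 * h / τ) ^ η * φ ^ η)) := by gcongr
    _ = _ := by simp only [h]; ring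

/-- With r = N / n and e = ε / 3 the right-hand side is 1 / φ. Note 512 = 4 · 128, 48 C / ε = 16 C /
e, and 1 + 4/η = 4(1 + 1/η) - 3. -/
theorem le_inv_of_mainConstant_le {C η ε r : ℝ} (hC : 0 < C) (_ : 0 < η) (hε : 0 < ε)
    (hr : mainConstant C η * ε ^ (-2 - 2 / η) ≤ r) :
    128 * (ε / 3) * (16 * C / (ε / 3)) ^ (2 * (1 + 1 / η)) *
      (6 * (1 + 1 / η)) ^ (4 * (1 + 1 / η) - 3) ≤ (ε / 3) * r / 4 := by
  have e1 : (48 * C) ^ (2 + 2 / η) * ε ^ (-2 - 2 / η) =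
      (16 * C / (ε / 3)) ^ (2 * (1 + 1 / η)) := by
    have : -2 - 2 / η = -(2 * (1 + 1 / η)) := by ring
    rw [this, Real.rpow_neg hε.le, ← Real.inv_rpow hε.le]
    have : 2 + 2 / η = 2 * (1 + 1 / η) := by ring
    rw [this, ← Real.mul_rpow (by positivity) (by positivity)]
    congr 1
    field_simp
    norm_num
  have e2 : mainConstant C η * ε ^ (-2 - 2 / η) = 512 * (16 * C / (ε / 3)) ^ (2 * (1 + 1 / η)) *
      (6 * (1 + 1 / η)) ^ (4 * (1 + 1 / η) - 3) := by
    rw [← e1, mainConstant]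
    have h1 : 6 + 6 / η = 6 * (1 + 1 / η) := by ring
    have h2 : 1 + 4 / η = 4 * (1 + 1 / η) - 3 := by ring
    rw [h1, h2]
    ring
  rw [e2] at hr
  calc _ = (ε / 3) / 4 * (512 * (16 * C / (ε / 3)) ^ (2 * (1 + 1 / η)) *
      (6 * (1 + 1 / η)) ^ (4 * (1 + 1 / η) - 3)) := by ring
    _ ≤ (ε / 3) / 4 * r := by gcongr
    _ = _ := by ring

variable {C η e φ τ : ℝ}

/-- Hypothesis `hCh` gives A H e = 96 C h ≥ 32, so surplus powers of A H and of H are at least 1 and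
can be dropped. -/
theorem potential_small (hC : 0 < C) (hη : 0 < η) (he : 0 < e) (hCh : 1 / 3 ≤ C * (1 + 1 / η))
    (hφ : 0 < φ) (hτ : e / 9 ≤ τ)
    (hψ : 128 * e * (16 * C / e) ^ (2 * (1 + 1 / η)) * (6 * (1 + 1 / η)) ^ (4 * (1 + 1 / η) - 3)
      ≤ 1 / φ) (he1 : e ≤ 1) : 8 * C * φ ≤ τ := by
  have hh : 1 ≤ 1 + 1 / η := by have : 0 < 1 / η := by positivity
                                linarith
  set h := 1 + 1 / η
  set A := 16 * C / e with hA
  set H := 6 * h with hH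
  have hA0 : 0 < A := by positivity
  have hAe : A * e = 16 * C := by rw [hA]; field_simp
  have hAH : 32 ≤ A * H * e := by nlinarith
  have hAH1 : 1 ≤ A * H := by nlinarith [mul_pos hA0 (show 0 < H by positivity)]
  have hH1 : 1 ≤ H := by linarith
  have e1 : A ^ (2 * h) * H ^ (4 * h - 3) = A * (A * H) * (A * H) ^ (2 * h - 2) * H ^ (2 * h - 2) := by
    have a1 : A ^ (2 * h) = A ^ (2 : ℕ) * A ^ (2 * h - 2) := by
      rw [← Real.rpow_natCast, ← Real.rpow_add hA0]; congr 1; push_cast; ring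
    have a2 : H ^ (4 * h - 3) = H * H ^ (2 * h - 2) * H ^ (2 * h - 2) := by
      nth_rewrite 2 [← Real.rpow_one H]
      rw [← Real.rpow_add (by positivity), ← Real.rpow_add (by positivity)]; congr 1; ring
    rw [a1, a2, Real.mul_rpow hA0.le (by positivity)]
    ring
  have h1 : 1 ≤ (A * H) ^ (2 * h - 2) := Real.one_le_rpow hAH1 (by linarith)
  have h2 : 1 ≤ H ^ (2 * h - 2) := Real.one_le_rpow hH1 (by linarith)
  have h3 : 72 * C / e ≤ 1 / φ := by
    refine le_trans ?_ hψ
    rw [mul_assoc, e1]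
    have : 128 * e * (A * (A * H)) ≤
        128 * e * (A * (A * H) * (A * H) ^ (2 * h - 2) * H ^ (2 * h - 2)) := by
      have : A * (A * H) * 1 * 1 ≤ A * (A * H) * (A * H) ^ (2 * h - 2) * H ^ (2 * h - 2) := by
        gcongr
      nlinarith
    refine le_trans ?_ this
    rw [div_le_iff₀ he]
    calc 72 * C ≤ 128 * (16 * C) * 32 := by linarith
      _ ≤ 128 * (16 * C) * (A * H * e) := by gcongr
      _ = _ := by rw [← hAe]; ring
  rw [div_le_div_iff₀ he hφ] at h3
  linarith

theorem barrierError_le (hC : 0 < C) (hη : 0 < η) (he : 0 < e) (hCh : 1 / 3 ≤ C * (1 + 1 / η))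
    (hφ : 0 < φ) (hτ : e / 9 ≤ τ)
    (hψ : 128 * e * (16 * C / e) ^ (2 * (1 + 1 / η)) * (6 * (1 + 1 / η)) ^ (4 * (1 + 1 / η) - 3)
      ≤ 1 / φ) : barrierError C η φ τ ≤ e / 4 := by
  have hh : 1 ≤ 1 + 1 / η := by have : 0 < 1 / η := by positivity
                                linarith
  have hh3 := one_add_inv_rpow_le_three hη
  have hηh : 1 / η ≤ 1 + 1 / η := by linarith
  have hηh' : η * (1 + 1 / η) = η + 1 := by field_simp
  rw [barrierError]
  set h := 1 + 1 / η
  set A := 16 * C / e with hA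
  set H := 6 * h with hH
  have hA0 : 0 < A := by positivity
  have hH0 : 0 < H := by positivity
  have hτ0 : 0 < τ := lt_of_lt_of_le (by positivity) hτ
  have hAe : A * e = 16 * C := by rw [hA]; field_simp
  have hAeh : 16 / 3 ≤ A * e * h := by nlinarith
  set ψ := 128 * e * A ^ (2 * h) * H ^ (4 * h - 3) with hψdef
  have hψ0 : 0 < ψ := by positivity
  -- The exponents of the main constant are made for this: η h = η + 1, so ψ ^ η splits off A² H⁴,
  -- which absorbs the polynomial factors. The remaining η-th powers are compared by means of h ^ η
  -- ≤ 3.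
  have hψη : ψ ^ η = (128 * e * A ^ 2 * H) ^ η * (A ^ 2 * H ^ 4) := by
    have a1 : (A ^ (2 * h)) ^ η = (A ^ 2) ^ η * A ^ 2 := by
      rw [← Real.rpow_mul hA0.le, ← Real.rpow_natCast, ← Real.rpow_mul hA0.le, ← Real.rpow_add hA0]
      congr 1; push_cast; linarith
    have a2 : (H ^ (4 * h - 3)) ^ η = H ^ η * H ^ 4 := by
      rw [← Real.rpow_mul hH0.le, ← Real.rpow_natCast H 4, ← Real.rpow_add hH0]
      congr 1; push_cast; linarith
    rw [hψdef, Real.mul_rpow (by positivity) (by positivity),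
      Real.mul_rpow (by positivity) (by positivity), a1, a2,
      Real.mul_rpow (x := 128 * e * A ^ 2) (by positivity) (by positivity),
      Real.mul_rpow (x := 128 * e) (by positivity) (by positivity)]
    ring
  have hφψ : φ ^ η * ψ ^ η ≤ 1 := by
    rw [← Real.mul_rpow hφ.le hψ0.le]
    refine Real.rpow_le_one (by positivity) ?_ hη.le
    rw [le_div_iff₀ hφ] at hψ
    linarith
  have hle1 : (6 * H / e) ^ η ≤ 9 * (128 * e * A ^ 2 * H) ^ η := by
    calc (6 * H / e) ^ η ≤ (h ^ 2 * (128 * e * A ^ 2 * H)) ^ η := by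
          refine Real.rpow_le_rpow (by positivity) ?_ hη.le
          rw [div_le_iff₀ he]
          calc 6 * H ≤ 128 * H * (16 / 3) ^ 2 := by linarith
            _ ≤ 128 * H * (A * e * h) ^ 2 := by gcongr
            _ = _ := by ring
      _ = (h ^ η) ^ 2 * (128 * e * A ^ 2 * H) ^ η := by
          rw [Real.mul_rpow (by positivity) (by positivity), ← Real.rpow_natCast,
            ← Real.rpow_mul (by positivity), mul_comm _ η, Real.rpow_mul (by positivity),
            Real.rpow_natCast]
      _ ≤ 3 ^ 2 * (128 * e * A ^ 2 * H) ^ η := by gcongr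
      _ = _ := by norm_num
  have hle2 : 18432 * (C * h ^ 2 * H) ≤ A ^ 2 * H ^ 4 * e ^ 2 := by
    calc 18432 * (C * h ^ 2 * H) = 216 * H * h ^ 2 * (16 * C) * (16 / 3) := by ring
      _ ≤ 216 * H * h ^ 2 * (16 * C) * (A * e * h) := by gcongr
      _ = _ := by rw [← hAe, hH]; ring
  have hτ4 : 4 * h / τ ≤ 6 * H / e := by
    rw [div_le_div_iff₀ hτ0 he, hH]
    nlinarith
  calc C / η * (4 * h / τ) ^ (1 + η) * φ ^ η * (2 * h)
      ≤ C * h * (6 * H / e) ^ (1 + η) * φ ^ η * (2 * h) := by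
        have h1 : C / η ≤ C * h := by rw [div_eq_mul_one_div]; gcongr
        have h2 : (4 * h / τ) ^ (1 + η) ≤ (6 * H / e) ^ (1 + η) :=
          Real.rpow_le_rpow (by positivity) hτ4 (by linarith)
        gcongr
    _ = 12 / e * (C * h ^ 2 * H) * ((6 * H / e) ^ η * φ ^ η) := by
        rw [Real.rpow_add (by positivity), Real.rpow_one]; ring
    _ ≤ 12 / e * (A ^ 2 * H ^ 4 * e ^ 2 / 18432) * (9 * (128 * e * A ^ 2 * H) ^ η * φ ^ η) := by
        have : C * h ^ 2 * H ≤ A ^ 2 * H ^ 4 * e ^ 2 / 18432 := by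
          rw [le_div_iff₀ (by norm_num)]; linarith
        gcongr
    _ = 108 / 18432 * e * (φ ^ η * ψ ^ η) := by rw [hψη]; field_simp; ring
    _ ≤ 108 / 18432 * e * 1 := by gcongr
    _ ≤ e / 4 := by linarith

theorem one_sub_three_mul_le_cube {τ : ℝ} (hτ : τ ≤ 3) : 1 - 3 * τ ≤ (1 - τ) ^ 3 := by
  have h1 : (1 - τ) ^ 3 = 1 - 3 * τ + τ ^ 2 * (3 - τ) := by ring
  have h2 : 0 ≤ τ ^ 2 * (3 - τ) := mul_nonneg (sq_nonneg τ) (by linarith)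
  linarith

theorem upper_drift_le {e : ℝ} (he : 0 ≤ e) (he1 : e ≤ 1) :
    (1 + 2 * (e / 8)) * (1 + e / 8) ≤ 1 + 3 * e / 8 + e / 32 := by
  nlinarith

end Numerics

/-! ### The isotropic case. -/

section Isotropic

variable {n : ℕ} [NeZero n] {C η : ℝ} {ν : Measure (EuclideanSpace ℝ (Fin n))}
  [IsProbabilityMeasure ν]

/-- Isotropy keeps C from being too small: cutting a unit second moment at 1/h gives 1 ≤ 1/h + (C/η)
h ^ η, and h ^ η ≤ 3. -/
theorem RegularIsotropic.one_third_le (hν : RegularIsotropic C η ν) (hC : 0 < C) (hη : 0 < η) :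
    1 / 3 ≤ C * (1 + 1 / η) := by
  have hh3 := one_add_inv_rpow_le_three hη
  have hh0 : 0 < 1 + 1 / η := by positivity
  set h := 1 + 1 / η with hh
  rcases le_or_gt 1 (C * h) with h1 | h1
  · linarith
  · set b := EuclideanSpace.basisFun (Fin n) ℝ
    have htail := hν.tail b {0} (1 / h) (by positivity) (by
      rw [le_div_iff₀ hh0]; simpa using h1.le)
    simp only [Finset.sum_singleton] at htail
    have hint : Integrable (fun x => max (inner ℝ (b 0) x ^ 2 - 1 / h) 0) ν :=
      Integrable.sup ((integrable_inner_sq hν.memLp (b 0)).sub (integrable_const _))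
        (integrable_const 0)
    have h2 : ∫ x, inner ℝ (b 0) x ^ 2 ∂ν ≤
        ∫ x, (1 / h + max (inner ℝ (b 0) x ^ 2 - 1 / h) 0) ∂ν := by
      refine integral_mono (integrable_inner_sq hν.memLp (b 0)) ((integrable_const _).add hint)
        fun x => ?_
      have := le_max_left (inner ℝ (b 0) x ^ 2 - 1 / h) 0
      simp only
      linarith
    rw [hν.integral_inner_sq, b.norm_eq_one, integral_add (integrable_const _) hint] at h2
    simp only [integral_const, probReal_univ, one_smul] at h2
    have h3 : (1 / h) ^ (-η) = h ^ η := by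
      rw [Real.rpow_neg (by positivity), ← Real.inv_rpow (by positivity), one_div, inv_inv]
    rw [h3] at htail
    have h4 : C / η * h ^ η ≤ C / η * 3 := by gcongr
    have h5 : 1 - 1 / h ≤ C / η * 3 := by linarith
    have h6 : 1 - 1 / h = 1 / (η * h) := by rw [hh]; field_simp; ring
    rw [h6, div_le_iff₀ (by positivity)] at h5
    have h7 : C / η * 3 * (η * h) = 3 * (C * h) := by field_simp
    linarith

/-- If u and l are the upper and lower deviations and z is the deviation in direction b, then u ≥ z
and l ≥ -z. Hence both are at least -|z| and max u l ≤ u + l + |z|, a bound that can be integrated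
term by term. -/
theorem norm_mean_sub_one_le {N : ℕ} (hN : 0 < N) (c : ℝ) (b : EuclideanSpace ℝ (Fin n))
    (hb : ‖b‖ = 1) (x : Fin N → EuclideanSpace ℝ (Fin n)) :
    ‖(1 / (N : ℝ)) • ∑ i, Matrix.vecMulVec (x i).ofLp (x i).ofLp - 1‖ ≤
      1 / N * topEig ((1 : ℝ) • ∑ i, Matrix.vecMulVec (x i).ofLp (x i).ofLp
        - c • (1 : Matrix (Fin n) (Fin n) ℝ)) +
      (1 / N * topEig ((-1 : ℝ) • ∑ i, Matrix.vecMulVec (x i).ofLp (x i).ofLp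
        - c • (1 : Matrix (Fin n) (Fin n) ℝ)) +
      (2 * c / N + |1 / (N : ℝ) * ∑ i, inner ℝ b (x i) ^ 2 - 1|)) := by
  have hN' : (0 : ℝ) < N := by exact_mod_cast hN
  set S := ∑ i, Matrix.vecMulVec (x i).ofLp (x i).ofLp with hS
  have hherm : ((1 / (N : ℝ)) • S - 1).IsHermitian := by
    ext i j
    simp [hS, Matrix.sum_apply, Matrix.vecMulVec_apply, mul_comm, Matrix.one_apply, eq_comm]
  set u := topEig ((1 : ℝ) • S - c • (1 : Matrix (Fin n) (Fin n) ℝ))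
  set l := topEig ((-1 : ℝ) • S - c • (1 : Matrix (Fin n) (Fin n) ℝ))
  have hu : ∀ v : EuclideanSpace ℝ (Fin n), ‖v‖ = 1 →
      quadForm ((1 / (N : ℝ)) • S - 1) v ≤ 1 / N * u + c / N - 1 := fun v hv => by
    have := quadForm_le_topEig ((1 : ℝ) • S - c • (1 : Matrix (Fin n) (Fin n) ℝ)) hv
    rw [quadForm_sub, quadForm_smul, quadForm_smul, quadForm_one, hv] at this
    rw [quadForm_sub, quadForm_smul, quadForm_one, hv]
    have : 1 / (N : ℝ) * quadForm S v ≤ 1 / N * (u + c) := by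
      gcongr; linarith
    have e : 1 / (N : ℝ) * (u + c) = 1 / N * u + c / N := by ring
    linarith
  have hl : ∀ v : EuclideanSpace ℝ (Fin n), ‖v‖ = 1 →
      quadForm (-((1 / (N : ℝ)) • S - 1)) v ≤ 1 / N * l + c / N + 1 := fun v hv => by
    have := quadForm_le_topEig ((-1 : ℝ) • S - c • (1 : Matrix (Fin n) (Fin n) ℝ)) hv
    rw [quadForm_sub, quadForm_smul, quadForm_smul, quadForm_one, hv] at this
    rw [quadForm_neg, quadForm_sub, quadForm_smul, quadForm_one, hv]
    have : 1 / (N : ℝ) * (-quadForm S v) ≤ 1 / N * (l + c) := by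
      gcongr; linarith
    have e : 1 / (N : ℝ) * (l + c) = 1 / N * l + c / N := by ring
    linarith
  have hs : quadForm ((1 / (N : ℝ)) • S - 1) b = 1 / (N : ℝ) * ∑ i, inner ℝ b (x i) ^ 2 - 1 := by
    rw [quadForm_sub, quadForm_smul, quadForm_one, hb, hS, quadForm_sum]
    simp_rw [quadForm_vecMulVec]
    norm_num
  have h1 := hu b hb
  have h2 := hl b hb
  rw [quadForm_neg] at h2
  rw [hs] at h1 h2
  have h3 := le_abs_self (1 / (N : ℝ) * ∑ i, inner ℝ b (x i) ^ 2 - 1)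
  have h4 := neg_abs_le (1 / (N : ℝ) * ∑ i, inner ℝ b (x i) ^ 2 - 1)
  have e2 : 2 * c / (N : ℝ) = c / N + c / N := by ring
  refine (norm_le_max_topEig hherm).trans (max_le ?_ ?_)
  · have := topEig_le hu
    linarith
  · have := topEig_le hl
    linarith

set_option maxHeartbeats 1000000 in
theorem integral_norm_mean_sub_one_le (hν : RegularIsotropic C η ν) (hC : 0 < C) (hη : 0 < η)
    {ε : ℝ} (hε : 0 < ε) (hε1 : ε < 1) {N : ℕ}
    (hN : mainConstant C η * ε ^ (-2 - 2 / η) * (n : ℝ) ≤ N) :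
    ∫ x : Fin N → EuclideanSpace ℝ (Fin n),
      ‖(1 / (N : ℝ)) • ∑ i, Matrix.vecMulVec (x i).ofLp (x i).ofLp - 1‖
        ∂(Measure.pi fun _ => ν) ≤ ε := by
  have hn1 : (1 : ℝ) ≤ n := by exact_mod_cast NeZero.one_le
  have hn0 : (0 : ℝ) < n := by linarith
  have hN0 : (0 : ℝ) < N := by
    refine lt_of_lt_of_le ?_ hN
    unfold mainConstant
    positivity
  have hNpos : 0 < N := by exact_mod_cast hN0
  have hCh := hν.one_third_le hC hη
  set e := ε / 3 with he
  have he0 : 0 < e := by positivity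
  have he1 : e ≤ 1 / 3 := by linarith
  -- Makes the starting barrier c = n / φ cost c / N = e / 4 on each side.
  set φ := 4 * n / (e * N) with hφ
  have hφ0 : 0 < φ := by positivity
  set κ := e / 8 with hκ
  have hκ0 : 0 < κ := by positivity
  set τ := κ / (1 + 2 * κ) with hτ
  have hτ9 : e / 9 ≤ τ := by
    rw [hτ, hκ, div_le_div_iff₀ (by norm_num) (by positivity)]; nlinarith
  have hτ0 : 0 < τ := by positivity
  have hτ8 : τ ≤ e / 8 := by
    rw [hτ, div_le_iff₀ (by positivity)]; nlinarith
  have hψ : 128 * e * (16 * C / e) ^ (2 * (1 + 1 / η)) *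
      (6 * (1 + 1 / η)) ^ (4 * (1 + 1 / η) - 3) ≤ 1 / φ := by
    refine (le_inv_of_mainConstant_le (r := N / n) hC hη hε ?_).trans (le_of_eq ?_)
    · rwa [le_div_iff₀ hn0]
    · rw [hφ]; field_simp; rw [he]; ring
  have hsmall := potential_small hC hη he0 hCh hφ0 hτ9 hψ (by linarith)
  have hB := barrierError_le hC hη he0 hCh hφ0 hτ9 hψ
  have hB1 := tail_le_barrierError (c := 1) hC hη hφ0 hτ0 (by linarith) (by norm_num) (by norm_num)
  have hB2 := tail_le_barrierError (c := 2) hC hη hφ0 hτ0 (by linarith) (by norm_num) (by norm_num)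
  rw [div_one] at hB1
  set c := (n : ℝ) / φ with hc
  have hc0 : 0 < c := by positivity
  have hcN : c / N = e / 4 := by rw [hc, hφ]; field_simp
  set M₀ : Matrix (Fin n) (Fin n) ℝ := c • 1 with hM₀
  have hM₀pd : M₀.PosDef := Matrix.PosDef.one.smul hc0
  have hM₀tr : M₀⁻¹.trace ≤ φ := by
    have : M₀⁻¹ = c⁻¹ • 1 := by
      apply Matrix.inv_eq_right_inv
      rw [hM₀, Matrix.smul_mul, one_mul, smul_smul, mul_inv_cancel₀ hc0.ne', one_smul]
    rw [this, Matrix.trace_smul, Matrix.trace_one, Fintype.card_fin, hc, smul_eq_mul]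
    refine le_of_eq ?_
    field_simp
  have hup := integral_topEig_le hν.memLp (φ := φ) (σ := 1)
    (fun M hM htr => exists_upper_shift hν hC hη hφ0 hκ0 hsmall hM htr) N M₀ hM₀pd hM₀tr
  have hlow := integral_topEig_le hν.memLp (φ := φ) (σ := -1)
    (fun M hM htr => exists_lower_shift hν hC hη hφ0 hτ0 (by linarith) hsmall hM htr) N M₀ hM₀pd
    hM₀tr
  rw [← hτ] at hup
  change _ ≤ (N : ℝ) * ((1 + 2 * κ) * (1 + κ) + barrierError C η φ τ) at hup
  set b := EuclideanSpace.basisFun (Fin n) ℝ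
  set T := τ / φ with hT
  have hCT : C ≤ T := by rw [hT, le_div_iff₀ hφ0]; nlinarith
  have htail := hν.tail b {0} T (by positivity) (by simpa using hCT)
  simp only [Finset.sum_singleton] at htail
  have hf := integrable_inner_sq hν.memLp (b 0)
  have hdev := integral_abs_mean_sub_one_le (ν := ν) hf (fun x => sq_nonneg _)
    (by rw [hν.integral_inner_sq, b.norm_eq_one, one_pow]) (T := T) (a := e / 2) (by positivity)
    (by positivity) hNpos
  have hTN : T / N / (2 * (e / 2)) ≤ e / 32 := by
    have : T / N / (2 * (e / 2)) = τ / (4 * n) := by rw [hT, hφ]; field_simp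
    rw [this, div_le_iff₀ (by positivity)]
    nlinarith
  have i1 := (integrable_topEig hν.memLp N 1 M₀).const_mul (1 / (N : ℝ))
  have i2 := (integrable_topEig hν.memLp N (-1) M₀).const_mul (1 / (N : ℝ))
  have i3 : Integrable (fun x : Fin N → EuclideanSpace ℝ (Fin n) =>
      |1 / (N : ℝ) * ∑ i, inner ℝ (b 0) (x i) ^ 2 - 1|) (Measure.pi fun _ => ν) :=
    (((integrable_finsetSum _ fun i _ => integrable_comp_eval (μ := fun _ : Fin N => ν)
      hf).const_mul _).sub (integrable_const 1)).abs
  have i4 : Integrable (fun x : Fin N → EuclideanSpace ℝ (Fin n) =>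
      2 * c / N + |1 / (N : ℝ) * ∑ i, inner ℝ (b 0) (x i) ^ 2 - 1|) (Measure.pi fun _ => ν) :=
    (integrable_const _).add i3
  refine (integral_mono (integrable_norm_smul_sum_vecMulVec_sub hν.memLp N _ _)
    (i1.add (i2.add i4)) fun x => norm_mean_sub_one_le hNpos c (b 0) (b.norm_eq_one 0) x).trans ?_
  rw [integral_add' i1 (i2.add i4), integral_add' i2 i4, integral_add (integrable_const _) i3,
    integral_const_mul, integral_const_mul, integral_const, probReal_univ, smul_eq_mul (1 : ℝ),
    one_mul]
  have hup' := mul_le_mul_of_nonneg_left hup (by positivity : (0 : ℝ) ≤ 1 / N)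
  have hlow' := mul_le_mul_of_nonneg_left hlow (by positivity : (0 : ℝ) ≤ 1 / N)
  rw [← mul_assoc, one_div_mul_cancel hN0.ne', one_mul] at hup' hlow'
  have h3τ := one_sub_three_mul_le_cube (τ := τ) (by linarith)
  have e2 : 2 * c / (N : ℝ) = e / 2 := by
    have : 2 * c / (N : ℝ) = 2 * (c / N) := by ring
    rw [this, hcN]; ring
  rw [e2]
  have hκ2 : (1 + 2 * κ) * (1 + κ) ≤ 1 + 3 * e / 8 + e / 32 :=
    upper_drift_le he0.le (by linarith)
  have hε3 : ε = 3 * e := by rw [he]; ring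
  rw [hε3]
  have htail0 : 0 ≤ C / η * T ^ (-η) := by positivity
  -- In units of e: upper barrier 13/32 + 1/4, lower barrier 3/8 + 1/8, starting barriers 1/2,
  -- scalar deviation 1/16 + 1/4 + 1/32. The total 2 is below the available 3.
  linarith

end Isotropic

/-! ### From tail probabilities to expected excess. -/

section Tail

/-- The layer-cake formula, with C t^{-1-η} integrated from t₀ to infinity. -/
theorem integral_pos_part_le_of_tail {Ω : Type*} [MeasurableSpace Ω] {P : Measure Ω}
    [IsProbabilityMeasure P] {f : Ω → ℝ} (hf : Integrable f P) {C η t₀ : ℝ} (hη : 0 < η)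
    (ht₀ : 0 < t₀) (htail : ∀ t, t₀ < t → P.real {ω | t < f ω} ≤ C * t ^ (-1 - η)) :
    ∫ ω, max (f ω - t₀) 0 ∂P ≤ C / η * t₀ ^ (-η) := by
  have hint : Integrable (fun ω => max (f ω - t₀) 0) P :=
    Integrable.sup (hf.sub (integrable_const _)) (integrable_const 0)
  rw [hint.integral_eq_integral_meas_lt (Filter.Eventually.of_forall fun ω => le_max_right _ _)]
  have hpow : IntegrableOn (fun t : ℝ => (t + t₀) ^ (-1 - η)) (Set.Ioi 0) :=
    integrableOn_add_rpow_Ioi_of_lt (by linarith) (by linarith)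
  have hval : ∫ t in Set.Ioi (0 : ℝ), (t + t₀) ^ (-1 - η) = t₀ ^ (-η) / η := by
    have hd : ∀ x ∈ Set.Ici (0 : ℝ),
        HasDerivAt (fun t => (t + t₀) ^ (-η) / (-η)) ((x + t₀) ^ (-1 - η)) x := by
      intro x hx
      have hx' : x + t₀ ≠ 0 := by have := Set.mem_Ici.1 hx; linarith
      convert! (((hasDerivAt_id x).add_const t₀).rpow_const (p := -η) (Or.inl hx')).div_const (-η)
        using 1
      simp only [id_eq, one_mul]
      rw [show -η - 1 = -1 - η by ring]
      field_simp
    have ht : Filter.Tendsto (fun t => (t + t₀) ^ (-η) / (-η)) Filter.atTop (nhds (0 / (-η))) :=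
      (((tendsto_rpow_neg_atTop hη).comp
        (Filter.tendsto_atTop_add_const_right _ t₀ Filter.tendsto_id))).div_const _
    rw [integral_Ioi_of_hasDerivAt_of_tendsto' hd hpow ht]
    simp [div_neg]
  calc ∫ t in Set.Ioi (0 : ℝ), P.real {ω | t < max (f ω - t₀) 0}
      ≤ ∫ t in Set.Ioi (0 : ℝ), C * (t + t₀) ^ (-1 - η) := by
        refine integral_mono_of_nonneg (Filter.Eventually.of_forall fun t => measureReal_nonneg)
          (hpow.const_mul C) ?_
        filter_upwards [ae_restrict_mem measurableSet_Ioi] with t ht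
        have ht0 : 0 < t := ht
        refine le_trans (le_of_eq ?_) (htail (t + t₀) (by linarith))
        congr 1
        ext ω
        simp only [Set.mem_ofPred_eq, lt_max_iff]
        constructor
        · rintro (h | h) <;> linarith
        · intro h; left; linarith
    _ = C / η * t₀ ^ (-η) := by rw [integral_const_mul, hval]; ring

theorem norm_sq_starProjection_span {n : ℕ}
    (b : OrthonormalBasis (Fin n) ℝ (EuclideanSpace ℝ (Fin n))) (I : Finset (Fin n))
    (x : EuclideanSpace ℝ (Fin n)) :
    ‖(Submodule.span ℝ (b '' (I : Set (Fin n)))).starProjection x‖ ^ 2 =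
      ∑ i ∈ I, inner ℝ (b i) x ^ 2 := by
  set U := Submodule.span ℝ (b '' (I : Set (Fin n)))
  rw [← b.sum_sq_norm_inner_right]
  have h : ∀ i, inner ℝ (b i) (U.starProjection x) = if i ∈ I then inner ℝ (b i) x else 0 := by
    intro i
    rw [← Submodule.inner_starProjection_left_eq_right]
    split_ifs with hi
    · rw [Submodule.starProjection_eq_self_iff.2
        (Submodule.subset_span (Set.mem_image_of_mem _ hi))]
    · have : U.starProjection (b i) = 0 := by
        rw [Submodule.starProjection_apply_eq_zero_iff, Submodule.mem_orthogonal]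
        intro u hu
        induction hu using Submodule.span_induction with
        | mem u hu =>
          obtain ⟨j, hj, rfl⟩ := hu
          exact b.inner_eq_zero (fun h => hi (h ▸ hj))
        | zero => simp
        | add u v _ _ hu hv => rw [inner_add_left, hu, hv, add_zero]
        | smul c u _ hu => rw [inner_smul_left, hu, mul_zero]
      rw [this, inner_zero_left]
  simp_rw [h]
  rw [← Finset.sum_subset (Finset.subset_univ I) fun i _ hi => by simp [hi]]
  exact Finset.sum_congr rfl fun i hi => by rw [if_pos hi, Real.norm_eq_abs, sq_abs]

end Tail

/-! ### Reduction to isotropic vectors. -/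

section Whitening

variable {n : ℕ}

theorem invSqrt_isHermitian (S : Matrix (Fin n) (Fin n) ℝ) : (invSqrt S).IsHermitian :=
  cfc_predicate (fun x : ℝ => x ^ (-(1 / 2) : ℝ)) S

theorem invSqrt_mul_mul_invSqrt {S : Matrix (Fin n) (Fin n) ℝ} (hS : S.PosDef) :
    invSqrt S * S * invSqrt S = 1 := by
  have hsa : IsSelfAdjoint S := hS.isHermitian
  have hpos : ∀ x ∈ spectrum ℝ S, 0 < x := by
    rw [hS.isHermitian.spectrum_real_eq_range_eigenvalues]
    rintro _ ⟨i, rfl⟩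
    exact hS.eigenvalues_pos i
  have hcont : ContinuousOn (fun x : ℝ => x ^ (-(1 / 2) : ℝ)) (spectrum ℝ S) := fun x hx =>
    (Real.continuousAt_rpow_const x _ (Or.inl (hpos x hx).ne')).continuousWithinAt
  have h1 : invSqrt S * S = cfc (fun x : ℝ => x ^ (-(1 / 2) : ℝ) * x) S := by
    rw [cfc_mul (fun x : ℝ => x ^ (-(1 / 2) : ℝ)) (fun x => x) S hcont continuousOn_id,
      cfc_id' ℝ S hsa, invSqrt]
  rw [h1, invSqrt, ← cfc_mul (fun x : ℝ => x ^ (-(1 / 2) : ℝ) * x) (fun x : ℝ => x ^ (-(1 / 2) : ℝ)) S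
    (hcont.mul continuousOn_id) hcont, ← cfc_const_one ℝ S hsa]
  refine cfc_congr fun x hx => ?_
  have hx0 := hpos x hx
  nth_rewrite 2 [← Real.rpow_one x]
  rw [← Real.rpow_add hx0, ← Real.rpow_add hx0]
  norm_num

/-- Multiplication by `S^{-1/2}` as a continuous linear map. -/
noncomputable def whiteningMap (S : Matrix (Fin n) (Fin n) ℝ) :
    EuclideanSpace ℝ (Fin n) →L[ℝ] EuclideanSpace ℝ (Fin n) :=
  Matrix.toEuclideanCLM (n := Fin n) (𝕜 := ℝ) (invSqrt S)

theorem ofLp_whiteningMap (S : Matrix (Fin n) (Fin n) ℝ) (x : EuclideanSpace ℝ (Fin n)) :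
    (whiteningMap S x).ofLp = invSqrt S *ᵥ x.ofLp :=
  Matrix.ofLp_toEuclideanCLM _ _

theorem whitened_eq {Ω : Type*} [MeasurableSpace Ω] (X : Ω → EuclideanSpace ℝ (Fin n))
    (P : Measure Ω) : whitened X P = fun ω => whiteningMap (covarianceMatrix X P) (X ω) := by
  ext ω i
  rw [ofLp_whiteningMap]
  rfl

theorem inner_whiteningMap (S : Matrix (Fin n) (Fin n) ℝ) (v x : EuclideanSpace ℝ (Fin n)) :
    inner ℝ v (whiteningMap S x) = inner ℝ (whiteningMap S v) x := by
  have h : (invSqrt S)ᵀ = invSqrt S := by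
    have := invSqrt_isHermitian S
    rwa [Matrix.IsHermitian, Matrix.conjTranspose_eq_transpose_of_trivial] at this
  simp only [EuclideanSpace.inner_eq_star_dotProduct, ofLp_whiteningMap, star_trivial]
  rw [dotProduct_comm, Matrix.dotProduct_mulVec, ← Matrix.mulVec_transpose, h, dotProduct_comm]

variable {μ : Measure (EuclideanSpace ℝ (Fin n))}

theorem integral_inner_sq_eq_quadForm (hμ : MemLp id 2 μ) (v : EuclideanSpace ℝ (Fin n)) :
    ∫ x, inner ℝ v x ^ 2 ∂μ = quadForm (covarianceMatrix id μ) v := by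
  have hcoord : ∀ i, MemLp (fun x : EuclideanSpace ℝ (Fin n) => x i) 2 μ := fun i => by
    have h : (fun x : EuclideanSpace ℝ (Fin n) => x i) =
        fun x => inner ℝ (EuclideanSpace.single i (1 : ℝ)) (id x) := by
      ext x
      simp [EuclideanSpace.inner_single_left]
    rw [h]
    exact MemLp.const_inner (𝕜 := ℝ) (EuclideanSpace.single i (1 : ℝ)) hμ
  have hprod : ∀ i j, Integrable (fun x : EuclideanSpace ℝ (Fin n) => x i * x j) μ := fun i j =>
    (hcoord i).integrable_mul (hcoord j)
  have hexp : ∀ x : EuclideanSpace ℝ (Fin n),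
      inner ℝ v x ^ 2 = ∑ i, ∑ j, v i * v j * (x i * x j) := fun x => by
    rw [EuclideanSpace.inner_eq_star_dotProduct, pow_two]
    simp only [dotProduct, Finset.sum_mul_sum, star_trivial]
    exact Finset.sum_congr rfl fun i _ => Finset.sum_congr rfl fun j _ => by ring
  simp_rw [hexp]
  rw [integral_finsetSum _ fun i _ => integrable_finsetSum _ fun j _ => (hprod i j).const_mul _]
  simp only [quadForm, dotProduct, Matrix.mulVec, covarianceMatrix, Matrix.of_apply, id_eq,
    Finset.mul_sum]
  refine Finset.sum_congr rfl fun i _ => ?_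
  rw [integral_finsetSum _ fun j _ => (hprod i j).const_mul _]
  refine Finset.sum_congr rfl fun j _ => ?_
  rw [integral_const_mul]
  ring

theorem quadForm_whiteningMap {S : Matrix (Fin n) (Fin n) ℝ} (hS : S.PosDef)
    (v : EuclideanSpace ℝ (Fin n)) : quadForm S (whiteningMap S v) = ‖v‖ ^ 2 := by
  have h : quadForm S (whiteningMap S v) = quadForm (invSqrt S * S * invSqrt S) v := by
    have hT : (invSqrt S)ᵀ = invSqrt S := by
      have := invSqrt_isHermitian S
      rwa [Matrix.IsHermitian, Matrix.conjTranspose_eq_transpose_of_trivial] at this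
    rw [quadForm, quadForm, ofLp_whiteningMap, ← Matrix.mulVec_mulVec, ← Matrix.mulVec_mulVec,
      Matrix.dotProduct_mulVec v.ofLp, ← Matrix.mulVec_transpose, hT]
  rw [h, invSqrt_mul_mul_invSqrt hS, quadForm_one]

/-- The span of the b i with i ∈ I has dimension |I|, so (SR) covers every level above t ≥ C |I| and
the layer-cake bound applies. -/
theorem regularIsotropic_map_whiteningMap [IsProbabilityMeasure μ] {C η : ℝ} (hη : 0 < η)
    (hμ : MemLp id 2 μ) (hS : (covarianceMatrix id μ).PosDef)
    (hSR : StrongRegularity C η (whitened id μ) μ) :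
    RegularIsotropic C η (μ.map (whiteningMap (covarianceMatrix id μ))) := by
  set S := covarianceMatrix id μ
  have hTm : Measurable (whiteningMap S) := (whiteningMap S).continuous.measurable
  have : IsProbabilityMeasure (μ.map (whiteningMap S)) :=
    Measure.isProbabilityMeasure_map hTm.aemeasurable
  have hmem : MemLp id 2 (μ.map (whiteningMap S)) := by
    rw [memLp_map_measure_iff (by fun_prop) hTm.aemeasurable]
    exact (whiteningMap S).comp_memLp' hμ
  refine ⟨hmem, fun v => ?_, fun b I t ht hCt => ?_⟩
  · rw [integral_map hTm.aemeasurable (by fun_prop)]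
    simp_rw [inner_whiteningMap]
    rw [integral_inner_sq_eq_quadForm hμ, quadForm_whiteningMap hS]
  · refine integral_pos_part_le_of_tail (integrable_sum_inner_sq hmem b I) hη ht fun s hs => ?_
    set U := Submodule.span ℝ (b '' (I : Set (Fin n)))
    have hfin : (Module.finrank ℝ U : ℝ) = I.card := by
      have hli : LinearIndependent ℝ fun i : (I : Set (Fin n)) => b i :=
        b.orthonormal.linearIndependent.comp _ Subtype.val_injective
      have hcard := finrank_span_eq_card hli
      rw [← Set.image_eq_range] at hcard
      simp [U, hcard]
    have h := hSR U s (by rw [hfin]; linarith)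
    refine le_trans (le_of_eq ?_) h
    rw [map_measureReal_apply hTm (measurableSet_lt measurable_const (by fun_prop)), whitened_eq]
    congr 1
    ext x
    simp only [Set.mem_preimage, Set.mem_ofPred_eq, U]
    rw [norm_sq_starProjection_span]
    rfl

theorem norm_sampleCovariance_sub_le {S : Matrix (Fin n) (Fin n) ℝ} (hS : S.PosDef) {N : ℕ}
    (x : Fin N → EuclideanSpace ℝ (Fin n)) :
    ‖sampleCovariance x - S‖ ≤ ‖S‖ * ‖(1 / (N : ℝ)) • ∑ i, Matrix.vecMulVec
      (whiteningMap S (x i)).ofLp (whiteningMap S (x i)).ofLp - 1‖ := by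
  set W := invSqrt S with hW
  set Q := S * W with hQ
  have h1 : W * Q = 1 := by rw [hQ, ← mul_assoc]; exact invSqrt_mul_mul_invSqrt hS
  have h2 : Q * W = 1 := mul_eq_one_comm.1 h1
  have h3 : W * S * W = 1 := invSqrt_mul_mul_invSqrt hS
  -- W commutes with S, because W S = W S (W Q) = (W S W) Q = Q. So Q is symmetric with square S,
  -- and ‖Q‖² = ‖S‖ by the C*-identity.
  have h4 : W * S = Q := by
    calc W * S = Q * W * (W * S) := by rw [h2, one_mul]
      _ = S * W * W * (W * S) := by rw [hQ]
      _ = W * S := by rw [← hQ, h2, one_mul]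
      _ = W * S * (W * Q) := by rw [h1, mul_one]
      _ = W * S * W * Q := by rw [← mul_assoc]
      _ = Q := by rw [h3, one_mul]
  have hQT : Qᵀ = Q := by
    have hWT : Wᵀ = W := by
      have := invSqrt_isHermitian S
      rwa [Matrix.IsHermitian, Matrix.conjTranspose_eq_transpose_of_trivial] at this
    have hST : Sᵀ = S := by
      have := hS.isHermitian
      rwa [Matrix.IsHermitian, Matrix.conjTranspose_eq_transpose_of_trivial] at this
    rw [hQ, Matrix.transpose_mul, hWT, hST, h4]
  have hQQ : Q * Q = S := by
    nth_rewrite 2 [← h4]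
    rw [← mul_assoc, h2, one_mul]
  have hx : ∀ y : EuclideanSpace ℝ (Fin n), Q *ᵥ (whiteningMap S y).ofLp = y.ofLp := fun y => by
    rw [ofLp_whiteningMap, Matrix.mulVec_mulVec, h2, Matrix.one_mulVec]
  set B := (1 / (N : ℝ)) • ∑ i, Matrix.vecMulVec
      (whiteningMap S (x i)).ofLp (whiteningMap S (x i)).ofLp - 1 with hB
  have hconj : sampleCovariance x - S = Q * B * Q := by
    rw [hB, mul_sub, sub_mul, mul_one, hQQ, sampleCovariance, Matrix.mul_smul, Matrix.smul_mul,
      Finset.mul_sum, Finset.sum_mul]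
    congr 2
    refine Finset.sum_congr rfl fun i _ => ?_
    rw [Matrix.mul_vecMulVec, hx, Matrix.vecMulVec_mul, ← Matrix.mulVec_transpose, hQT, hx]
  have hnorm : ‖Q‖ * ‖Q‖ = ‖S‖ := by
    rw [← Matrix.l2_opNorm_conjTranspose_mul_self, Matrix.conjTranspose_eq_transpose_of_trivial,
      hQT, hQQ]
  calc ‖sampleCovariance x - S‖ ≤ ‖Q‖ * ‖B‖ * ‖Q‖ := by
        rw [hconj]
        exact (norm_mul_le _ _).trans (by gcongr; exact norm_mul_le _ _)
    _ = ‖S‖ * ‖B‖ := by rw [← hnorm]; ring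

theorem integral_norm_sampleCovariance_sub_le [IsProbabilityMeasure μ] {C η ε : ℝ} (hC : 0 < C)
    (hη : 0 < η) (hε : 0 < ε) (hε1 : ε < 1) (hμ : MemLp id 2 μ)
    (hS : (covarianceMatrix id μ).PosDef) (hSR : StrongRegularity C η (whitened id μ) μ) {N : ℕ}
    (hN : mainConstant C η * ε ^ (-2 - 2 / η) * (n : ℝ) ≤ N) :
    Integrable (fun x => ‖sampleCovariance x - covarianceMatrix id μ‖)
      (Measure.pi fun _ : Fin N => μ) ∧
    ∫ x, ‖sampleCovariance x - covarianceMatrix id μ‖ ∂(Measure.pi fun _ : Fin N => μ)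
      ≤ ε * ‖covarianceMatrix id μ‖ := by
  set S := covarianceMatrix id μ
  have hint : Integrable (fun x => ‖sampleCovariance x - S‖) (Measure.pi fun _ : Fin N => μ) :=
    integrable_norm_smul_sum_vecMulVec_sub hμ N _ S
  refine ⟨hint, ?_⟩
  -- In dimension 0 all norms vanish, while the isotropic argument needs a unit vector.
  rcases Nat.eq_zero_or_pos n with hn | hn
  · subst hn
    have h0 : ∀ A : Matrix (Fin 0) (Fin 0) ℝ, ‖A‖ = 0 := fun A => by
      rw [Subsingleton.elim A 0, norm_zero]
    simp [h0]
  · have : NeZero n := ⟨hn.ne'⟩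
    set T := whiteningMap S
    have hTm : Measurable T := T.continuous.measurable
    have hreg := regularIsotropic_map_whiteningMap hη hμ hS hSR
    have hprob : IsProbabilityMeasure (μ.map T) :=
      Measure.isProbabilityMeasure_map hTm.aemeasurable
    have hmain := integral_norm_mean_sub_one_le hreg hC hη hε hε1 hN
    have hpi : Measure.pi (fun _ : Fin N => μ.map T)
        = (Measure.pi fun _ : Fin N => μ).map fun x i => T (x i) :=
      (Measure.pi_map_pi (μ := fun _ : Fin N => μ) (f := fun _ => T)
        fun _ => hTm.aemeasurable).symm
    have hmeas : Measurable fun (x : Fin N → EuclideanSpace ℝ (Fin n)) i => T (x i) := by fun_prop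
    have hint2 := integrable_norm_smul_sum_vecMulVec_sub hreg.memLp N (1 / (N : ℝ)) 1
    rw [hpi] at hmain hint2
    rw [integral_map hmeas.aemeasurable hint2.aestronglyMeasurable] at hmain
    have hint3 := hint2.comp_measurable hmeas
    refine (integral_mono hint (hint3.const_mul ‖S‖)
      fun x => norm_sampleCovariance_sub_le hS x).trans ?_
    rw [integral_const_mul, mul_comm ε]
    gcongr
    exact hmain

end Whitening

/-! ### Passage from random vectors to their laws. -/

section Law

variable {Ω : Type*} [MeasurableSpace Ω] {n : ℕ} {P : Measure Ω}
  {X : Ω → EuclideanSpace ℝ (Fin n)}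

theorem covarianceMatrix_map (hX : AEMeasurable X P) :
    covarianceMatrix id (P.map X) = covarianceMatrix X P := by
  ext i j
  simp only [covarianceMatrix, Matrix.of_apply]
  rw [integral_map hX (by fun_prop)]
  rfl

theorem strongRegularity_map {C η : ℝ} (hX : AEMeasurable X P)
    (h : StrongRegularity C η (whitened X P) P) :
    StrongRegularity C η (whitened id (P.map X)) (P.map X) := by
  intro U t ht
  refine le_trans (le_of_eq ?_) (h U t ht)
  rw [whitened_eq, whitened_eq, covarianceMatrix_map hX,
    map_measureReal_apply_of_aemeasurable hX (measurableSet_lt measurable_const (by fun_prop))]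
  rfl

theorem measurable_norm_sampleCovariance_sub (N : ℕ) (S : Matrix (Fin n) (Fin n) ℝ) :
    Measurable fun x : Fin N → EuclideanSpace ℝ (Fin n) => ‖sampleCovariance x - S‖ :=
  (((continuous_sum_vecMulVec N).const_smul (1 / (N : ℝ))).sub continuous_const).norm.measurable

end Law

theorem corollary1p2 (C η ε : ℝ) (hC : 0 < C) (hη : 0 < η) (hε₀ : 0 < ε) (hε₁ : ε < 1) :
    (∀ (n N : ℕ) {Ω Ω' : Type*} [MeasurableSpace Ω] [MeasurableSpace Ω']
      (P : Measure Ω) [IsProbabilityMeasure P] (P' : Measure Ω') [IsProbabilityMeasure P']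
      (X : Ω → EuclideanSpace ℝ (Fin n)) (Y : Fin N → Ω' → EuclideanSpace ℝ (Fin n)),
      MemLp X 2 P →
      (covarianceMatrix X P).PosDef →
      StrongRegularity C η (whitened X P) P →
      mainConstant C η * ε ^ (-2 - 2 / η) * (n : ℝ) ≤ (N : ℝ) →
      iIndepFun Y P' →
      (∀ i, IdentDistrib (Y i) X P' P) →
      Integrable (fun ω => ‖sampleCovariance (fun i => Y i ω) - covarianceMatrix X P‖) P' ∧
      ∫ ω, ‖sampleCovariance (fun i => Y i ω) - covarianceMatrix X P‖ ∂P'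
        ≤ ε * ‖covarianceMatrix X P‖) ∧
    (∃ K : ℝ, ∀ n : ℕ, ∃ N₀ : ℕ,
      IsLeast (sufficientSampleSizes C η ε n) N₀ ∧ (N₀ : ℝ) ≤ K * (n : ℝ)) := by
  have hpos : 0 < mainConstant C η * ε ^ (-2 - 2 / η) := by
    unfold mainConstant
    positivity
  -- The extra 1 in K pays for rounding up when n ≥ 1; for n = 0 the ceiling is 0.
  refine ⟨?_, mainConstant C η * ε ^ (-2 - 2 / η) + 1, fun n => ?_⟩
  · intro n N Ω Ω' _ _ P _ P' _ X Y hX hS hSR hN hind hid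
    have hXm : AEMeasurable X P := hX.aestronglyMeasurable.aemeasurable
    have hprob : IsProbabilityMeasure (P.map X) := Measure.isProbabilityMeasure_map hXm
    have hYm : ∀ i, AEMeasurable (Y i) P' := fun i => (hid i).aemeasurable_fst
    have hYpi : AEMeasurable (fun ω i => Y i ω) P' := aemeasurable_pi_lambda _ hYm
    have hlaw : P'.map (fun ω i => Y i ω) = Measure.pi fun _ : Fin N => P.map X := by
      rw [(iIndepFun_iff_map_fun_eq_pi_map hYm).1 hind]
      congr 1
      ext1 i
      exact (hid i).map_eq
    have hmem : MemLp id 2 (P.map X) := (memLp_map_measure_iff (by fun_prop) hXm).2 hX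
    have hcov := covarianceMatrix_map hXm
    have hmain := integral_norm_sampleCovariance_sub_le hC hη hε₀ hε₁ hmem (by rwa [hcov])
      (strongRegularity_map hXm hSR) hN
    rw [hcov, ← hlaw] at hmain
    have hmeas := measurable_norm_sampleCovariance_sub N (covarianceMatrix X P)
    rw [integrable_map_measure hmeas.aestronglyMeasurable hYpi,
      integral_map hYpi hmeas.aestronglyMeasurable] at hmain
    exact hmain
  · have hmem : ⌈mainConstant C η * ε ^ (-2 - 2 / η) * (n : ℝ)⌉₊ ∈
        sufficientSampleSizes C η ε n := by
      intro N hN μ _ hμ hS hSR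
      exact integral_norm_sampleCovariance_sub_le hC hη hε₀ hε₁ hμ hS hSR (Nat.ceil_le.1 hN)
    refine ⟨sInf (sufficientSampleSizes C η ε n),
      ⟨Nat.sInf_mem ⟨_, hmem⟩, fun N hN => Nat.sInf_le hN⟩, ?_⟩
    refine (Nat.cast_le.2 (Nat.sInf_le hmem)).trans ?_
    rcases Nat.eq_zero_or_pos n with hn | hn
    · subst hn
      simp
    · have hn1 : (1 : ℝ) ≤ n := by exact_mod_cast hn
      have := (Nat.ceil_lt_add_one (mul_nonneg hpos.le (Nat.cast_nonneg n))).le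
      linarith
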